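/- Let $p,q,k\ge 0$ be integers, $n=p+q$, $v_1,\dots,v_n>0$, and $\mathbb{R}_n^+=\{x\in\mathbb{R}^n: x_1>0,\dots,x_n>0\}$. Let $S$ be the space of Schwartz functions on $\mathbb{R}^n$ that are even in each variable, and $S'$ its topological dual (tempered distributions, with the weak-$*$ topology). A function $f$ of polynomial growth on $\mathbb{R}_n^+$ is identified with the distribution $\langle f,\varphi\rangle=\int_{\mathbb{R}_n^+} f\varphi\prod_i x_i^{2v_i}\,dx$, and $\langle\delta,\varphi\rangle=\varphi(0)$. Put $$B_{x_i}=\frac{\partial^2}{\partial x_i^2}+\frac{2v_i}{x_i}\frac{\partial}{\partial x_i},\qquad \Diamond_B=(B_{x_1}+\cdots+B_{x_p})^2-(B_{x_{p+1}}+\cdots+B_{x_{p+q}})^2,$$ $$(F_Bf)(x)=C_v\int_{\mathbb{R}_n^+}f(y)\prod_{i=1}^n j_{v_i-\frac12}(x_iy_i)\,y_i^{2v_i}\,dy,\qquad (F_B^{-1}f)(x)=(F_Bf)(-x),\qquad C_v=\Big(\prod_{i=1}^n2^{v_i-\frac12}\Gamma(v_i+\tfrac12)\Big)^{-1},$$ where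 $j_\nu(t)=\Gamma(\nu+1)\sum_{m\ge0}\frac{(-1)^m(t/2)^{2m}}{m!\,\Gamma(m+\nu+1)}$ is the normalized Bessel function. Then $B_{x_i}$, $F_B$ and $F_B^{-1}$ map $S$ continuously into itself, and hence act on $S'$ by transposition, $\langle AT,\varphi\rangle=\langle T,A\varphi\rangle$. The Fourier–Bessel transform of $\Diamond_B^k\delta$ is the function $$F_B\Diamond_B^k\delta(x)=C_v\big[(x_1^2+\cdots+x_p^2)^2-(x_{p+1}^2+\cdots+x_{p+q}^2)^2\big]^k,$$ and $|F_B\Diamond_B^k\delta(x)|\le C_v\|x\|^{4k}$ for $x\in\mathbb{R}_n^+$, where $\|x\|=(x_1^2+\cdots+x_n^2)^{1/2}$. The operator $F_B\Diamond_B^k$ is continuous and bounded (it maps bounded sets to bounded sets) on $S'$. Moreover $$\Diamond_B^k\delta=C_v\,F_B^{-1}\big[(x_1^2+\cdots+x_p^2)^2-(x_{p+1}^2+\cdots+x_{p+q}^2)^2\big]^k\quad\text{in }S'.$$ -/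

import Mathlib

open scoped SchwartzMap

noncomputable section

namespace BesselDiamond

/-- The open orthant of all points of `ℝⁿ` with positive coordinates. -/
def orthant (n : ℕ) : Set (EuclideanSpace ℝ (Fin n)) := {x | ∀ i, 0 < x i}

/-- The weight `∏ xᵢ ^ (2 vᵢ)`. -/
def weight {n : ℕ} (v : Fin n → ℝ) (x : EuclideanSpace ℝ (Fin n)) : ℝ :=
  ∏ i, x i ^ (2 * v i)

/-- The normalized Bessel function
`j_ν(t) = Γ(ν+1) ∑ₘ (-1)ᵐ (t/2)²ᵐ / (m! Γ(m+ν+1)) = 2^ν Γ(ν+1) t^(-ν) J_ν(t)`. -/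
def normalizedBessel (ν t : ℝ) : ℝ :=
  Real.Gamma (ν + 1) *
    ∑' m : ℕ, (-1) ^ m * (t / 2) ^ (2 * m) / ((m.factorial : ℝ) * Real.Gamma (m + ν + 1))

/-- The constant `C_v = (∏ 2^(vᵢ - 1/2) Γ(vᵢ + 1/2))⁻¹`. -/
def fbConst {n : ℕ} (v : Fin n → ℝ) : ℝ :=
  (∏ i, (2 : ℝ) ^ (v i - 1 / 2) * Real.Gamma (v i + 1 / 2))⁻¹

/-- The Fourier–Bessel integral of a function on the orthant. -/
def fbIntegral {n : ℕ} (v : Fin n → ℝ) (f : EuclideanSpace ℝ (Fin n) → ℂ)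
    (x : EuclideanSpace ℝ (Fin n)) : ℂ :=
  (fbConst v : ℂ) * ∫ y in orthant n,
    f y * ((∏ i, normalizedBessel (v i - 1 / 2) (x i * y i) * y i ^ (2 * v i) : ℝ) : ℂ)

/-- The inverse Fourier–Bessel integral, `(F_B⁻¹ f)(x) = (F_B f)(-x)`. -/
def fbInvIntegral {n : ℕ} (v : Fin n → ℝ) (f : EuclideanSpace ℝ (Fin n) → ℂ)
    (x : EuclideanSpace ℝ (Fin n)) : ℂ :=
  fbIntegral v f (-x)

/-- The Bessel differential operator `∂²/∂xᵢ² + (2 vᵢ / xᵢ) ∂/∂xᵢ`; it is meant at points of the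
orthant only. -/
def besselDeriv {n : ℕ} (v : Fin n → ℝ) (i : Fin n) (f : EuclideanSpace ℝ (Fin n) → ℂ)
    (x : EuclideanSpace ℝ (Fin n)) : ℂ :=
  lineDeriv ℝ (fun y => lineDeriv ℝ f y (EuclideanSpace.single i 1)) x (EuclideanSpace.single i 1)
    + ((2 * v i / x i : ℝ) : ℂ) * lineDeriv ℝ f x (EuclideanSpace.single i 1)

/-- The test functions: Schwartz functions on `ℝⁿ` that are even in each variable, with the
topology of the Schwartz space. Such a function is determined by its values on the orthant
(see `EvenSchwartz.ext_orthant`). -/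
def EvenSchwartz (n : ℕ) : Submodule ℂ 𝓢(EuclideanSpace ℝ (Fin n), ℂ) where
  carrier := {φ | ∀ x y, (∀ i, x i = y i ∨ x i = -y i) → φ x = φ y}
  add_mem' := by
    intro a b ha hb x y h
    simp [ha x y h, hb x y h]
  zero_mem' := by
    intro x y _
    simp
  smul_mem' := by
    intro c a ha x y h
    simp [ha x y h]

theorem EvenSchwartz.ext_orthant {n : ℕ} {φ ψ : EvenSchwartz n}
    (h : ∀ x ∈ orthant n, φ.1 x = ψ.1 x) : φ = ψ := by
  apply Subtype.ext
  ext x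
  let a : EuclideanSpace ℝ (Fin n) := WithLp.toLp 2 fun i => |x i|
  let e : EuclideanSpace ℝ (Fin n) := WithLp.toLp 2 fun _ => 1
  have ha : ∀ i, x i = a i ∨ x i = -a i := fun i => by
    rcases abs_choice (x i) with hi | hi <;> simp [a, hi]
  rw [φ.2 x a ha, ψ.2 x a ha]
  have hc : Filter.Tendsto (fun t : ℝ => a + t • e) (nhdsWithin 0 (Set.Ioi 0)) (nhds a) := by
    have : Continuous fun t : ℝ => a + t • e := by fun_prop
    simpa using (this.tendsto 0).mono_left nhdsWithin_le_nhds
  have h1 := (φ.1.continuous.tendsto a).comp hc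
  have h2 := (ψ.1.continuous.tendsto a).comp hc
  refine tendsto_nhds_unique (h1.congr' ?_) h2
  filter_upwards [self_mem_nhdsWithin] with t ht
  refine h _ fun i => ?_
  have : 0 ≤ |x i| := abs_nonneg _
  simp only [a, e, PiLp.add_apply, PiLp.smul_apply, smul_eq_mul, mul_one]
  have ht' : 0 < t := ht
  linarith

/-- The tempered distributions: continuous linear functionals on the test functions, with the
topology of pointwise convergence. -/
abbrev EvenTempered (n : ℕ) := EvenSchwartz n →Lₚₜ[ℂ] ℂ

/-- The Dirac distribution `φ ↦ φ 0`. -/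
def delta (n : ℕ) : EvenTempered n :=
  ((TemperedDistribution.delta (0 : EuclideanSpace ℝ (Fin n)) :
      𝓢(EuclideanSpace ℝ (Fin n), ℂ) →L[ℂ] ℂ).comp (EvenSchwartz n).subtypeL)

/-- The continuous operator `L` on test functions is given on the orthant by the operation `A` on
functions. By `EvenSchwartz.ext_orthant` there is at most one such `L`. -/
def Realizes {n : ℕ}
    (A : (EuclideanSpace ℝ (Fin n) → ℂ) → EuclideanSpace ℝ (Fin n) → ℂ)
    (L : EvenSchwartz n →L[ℂ] EvenSchwartz n) : Prop :=
  ∀ φ : EvenSchwartz n, ∀ x ∈ orthant n, (L φ).1 x = A φ.1 x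

open Classical in
/-- The operator on test functions given on the orthant by `A`, if `A` maps test functions
continuously to test functions (and `0` if it does not). -/
def onTest {n : ℕ} (A : (EuclideanSpace ℝ (Fin n) → ℂ) → EuclideanSpace ℝ (Fin n) → ℂ) :
    EvenSchwartz n →L[ℂ] EvenSchwartz n :=
  if h : ∃ L, Realizes A L then h.choose else 0

/-- The action of `A` on distributions by transposition: `⟨A T, φ⟩ = ⟨T, A φ⟩`. -/
def onDist {n : ℕ} (A : (EuclideanSpace ℝ (Fin n) → ℂ) → EuclideanSpace ℝ (Fin n) → ℂ) :
    EvenTempered n →L[ℂ] EvenTempered n :=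
  PointwiseConvergenceCLM.precomp ℂ (onTest A)

/-- The Fourier–Bessel transform of distributions. -/
def fourierBessel {n : ℕ} (v : Fin n → ℝ) : EvenTempered n →L[ℂ] EvenTempered n :=
  onDist (fbIntegral v)

/-- The inverse Fourier–Bessel transform of distributions. -/
def fourierBesselInv {n : ℕ} (v : Fin n → ℝ) : EvenTempered n →L[ℂ] EvenTempered n :=
  onDist (fbInvIntegral v)

/-- The Bessel operator in the `i`-th variable on distributions; it is formally self-adjoint for
the weighted pairing `∫ f φ ∏ xᵢ^(2vᵢ) dx`. -/
def besselOp {n : ℕ} (v : Fin n → ℝ) (i : Fin n) : EvenTempered n →L[ℂ] EvenTempered n :=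
  onDist (besselDeriv v i)

/-- The Bessel diamond operator on distributions. -/
def diamondOp {p q : ℕ} (v : Fin (p + q) → ℝ) :
    EvenTempered (p + q) →L[ℂ] EvenTempered (p + q) :=
  (∑ i : Fin p, besselOp v (Fin.castAdd q i)) ^ 2
    - (∑ j : Fin q, besselOp v (Fin.natAdd p j)) ^ 2

/-- The polynomial `(x₁² + … + x_p²)² - (x_{p+1}² + … + x_{p+q}²)²`. -/
def diamondPoly {p q : ℕ} (x : EuclideanSpace ℝ (Fin (p + q))) : ℝ :=
  (∑ i : Fin p, x (Fin.castAdd q i) ^ 2) ^ 2 - (∑ j : Fin q, x (Fin.natAdd p j) ^ 2) ^ 2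

/-- The distribution `T` is the function `f`: `⟨T, φ⟩ = ∫ f φ ∏ xᵢ^(2vᵢ) dx` over the orthant, the
integral being absolutely convergent. -/
def IsFunction {n : ℕ} (v : Fin n → ℝ) (T : EvenTempered n)
    (f : EuclideanSpace ℝ (Fin n) → ℝ) : Prop :=
  ∀ φ : EvenSchwartz n,
    MeasureTheory.IntegrableOn (fun x => ((f x * weight v x : ℝ) : ℂ) * φ.1 x) (orthant n) ∧
      T φ = ∫ x in orthant n, ((f x * weight v x : ℝ) : ℂ) * φ.1 x

end BesselDiamond

end

noncomputable section

namespace BesselDiamond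

open Real Set Filter Topology MeasureTheory

/-! Everything takes place on the test functions, where three facts are needed: the Bessel operators
and the transform `F` are continuous there, `F` exchanges each Bessel operator with multiplication
by `-xᵢ²` in both directions, and `(F F φ)(0) = φ(0)`. The `◇_B` is a difference of squares, so the
signs cancel and `F` intertwines `◇_B^k` with multiplication by `P^k`, where `P` is `diamondPoly`.
Transposing, `⟨F ◇^k δ, φ⟩ = (◇^k F φ)(0) = (F (P^k φ))(0) = C_v ∫ P^k φ` with the weight, because
the kernel equals one at the origin. Applying this to `F φ` gives `(F (P^k F φ))(0) = (F F ◇^k φ)(0)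
= (◇^k φ)(0)`, which is the inversion statement. The inverse transform is `F` itself, since the
kernel is even. Full inversion is never needed, only inversion at the origin (`fbTest_fbTest_zero`).

Continuity into the Schwartz space comes from one criterion, `IsSchwartzFamily`: if a set of maps is
bounded by continuous seminorms and its span is stable under coordinates and partial derivatives,
then every linear map in the span is Schwartz valued and continuous. It is used twice: for division
of an odd function by `xᵢ`, which gives the singular part of the Bessel operator
(`exists_divDeriv`), and for the transform (`exists_fbTest`).

The analytic input is the one-variable theory of `j_ν` from its power series: the three-term
recurrence, the derivative formula, the bound `|j_ν| ≤ 1`, and the transform of a Gaussian.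
Derivatives of the transform are transforms with one exponent `vᵢ` raised by one (`bump`), so all
exponents are treated at once. Inversion at the origin comes from pairing `F φ` with a Gaussian that
is flattened to one. -/

/-! ### The normalized Bessel function of one variable. -/

/-- The coefficient of `t ^ (2 * m)` in the power series of `j_{v - 1/2}`. -/
def besselCoeff (v : ℝ) (m : ℕ) : ℝ :=
  (-1) ^ m / (4 ^ m * (m.factorial : ℝ)) * (Gamma (v + 1 / 2) / Gamma (m + v + 1 / 2))

theorem normalizedBessel_eq_tsum (v t : ℝ) :
    normalizedBessel (v - 1 / 2) t = ∑' m, besselCoeff v m * t ^ (2 * m) := by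
  unfold normalizedBessel besselCoeff
  rw [← tsum_mul_left]
  congr 1 with m
  have h1 : v - 1 / 2 + 1 = v + 1 / 2 := by ring
  have h2 : (m : ℝ) + (v - 1 / 2) + 1 = m + v + 1 / 2 := by ring
  rw [h1, h2, div_pow, pow_mul 2 2 m]
  norm_num
  ring

theorem gamma_ratio_succ {v : ℝ} (hv : 0 < v) (m : ℕ) :
    Gamma (v + 1 / 2) / Gamma ((m + 1 : ℕ) + v + 1 / 2) =
      Gamma (v + 1 / 2) / Gamma (m + v + 1 / 2) / (m + v + 1 / 2) := by
  have h : (((m + 1 : ℕ) : ℝ) + v + 1 / 2) = (m + v + 1 / 2) + 1 := by push_cast; ring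
  have hp : (0 : ℝ) < m + v + 1 / 2 := by positivity
  rw [h, Gamma_add_one hp.ne', div_div, mul_comm]

/-- Passing from `m` to `m + 1` divides the ratio by `m + v + 1/2`. The first divisor exceeds only
`1/2`, which produces the constant 2; all later divisors exceed one. -/
theorem gamma_ratio_bounds {v : ℝ} (hv : 0 < v) (m : ℕ) :
    0 < Gamma (v + 1 / 2) / Gamma (m + v + 1 / 2) ∧
      Gamma (v + 1 / 2) / Gamma (m + v + 1 / 2) ≤ 2 := by
  have hG : 0 < Gamma (v + 1 / 2) := Gamma_pos_of_pos (by positivity)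
  refine ⟨div_pos hG (Gamma_pos_of_pos (by positivity)), ?_⟩
  rcases m with _ | m
  · rw [Nat.cast_zero, zero_add, div_self hG.ne']
    norm_num
  induction m with
  | zero =>
    rw [gamma_ratio_succ hv]
    simp only [CharP.cast_eq_zero, zero_add, div_self hG.ne']
    rw [div_le_iff₀ (by positivity)]
    linarith
  | succ m ih =>
    rw [gamma_ratio_succ hv, div_le_iff₀ (by positivity)]
    refine ih.trans ?_
    push_cast
    have : (0 : ℝ) ≤ m := by positivity
    linarith

theorem abs_besselCoeff_le {v : ℝ} (hv : 0 < v) (m : ℕ) :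
    |besselCoeff v m| ≤ 2 * ((1 / 4) ^ m / m.factorial) := by
  obtain ⟨h0, h2⟩ := gamma_ratio_bounds hv m
  have hf : (0 : ℝ) < m.factorial := by exact_mod_cast m.factorial_pos
  rw [besselCoeff, abs_mul, abs_of_pos h0, abs_div, abs_pow, abs_neg, abs_one, one_pow,
    abs_of_pos (by positivity), mul_comm]
  refine (mul_le_mul_of_nonneg_right h2 (by positivity)).trans (le_of_eq ?_)
  rw [one_div_pow]
  field_simp

theorem summable_besselCoeff {v : ℝ} (hv : 0 < v) (t : ℝ) :
    Summable fun m => besselCoeff v m * t ^ (2 * m) := by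
  refine Summable.of_norm_bounded
    ((Real.summable_pow_div_factorial (1 / 4 * t ^ 2)).mul_left 2) fun m => ?_
  rw [norm_mul, norm_pow, pow_mul, norm_eq_abs, norm_eq_abs, sq_abs, mul_pow]
  refine (mul_le_mul_of_nonneg_right (abs_besselCoeff_le hv m) (by positivity)).trans
    (le_of_eq ?_)
  ring

/-- Coefficient form of `j_ν' = -t / (2ν + 2) · j_{ν+1}` with `ν = v - 1/2`. -/
theorem besselCoeff_succ {v : ℝ} (hv : 0 < v) (m : ℕ) :
    2 * (m + 1) * besselCoeff v (m + 1) = -(1 / (2 * v + 1)) * besselCoeff (v + 1) m := by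
  have hp : (0 : ℝ) < v + 1 / 2 := by positivity
  have hp' : (0 : ℝ) < m + v + 1 / 2 := by positivity
  have hG : Gamma (m + v + 1 / 2) ≠ 0 := (Gamma_pos_of_pos hp').ne'
  have h1 : v + 1 + 1 / 2 = (v + 1 / 2) + 1 := by ring
  have h2 : (m : ℝ) + (v + 1) + 1 / 2 = (m + v + 1 / 2) + 1 := by ring
  have hf : (m.factorial : ℝ) ≠ 0 := by exact_mod_cast m.factorial_ne_zero
  rw [besselCoeff, besselCoeff, gamma_ratio_succ hv, h1, h2, Gamma_add_one hp.ne',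
    Gamma_add_one hp'.ne', Nat.factorial_succ]
  push_cast
  field_simp
  ring

theorem besselCoeff_zero {v : ℝ} (hv : 0 < v) : besselCoeff v 0 = 1 := by
  have : Gamma (v + 1 / 2) ≠ 0 := (Gamma_pos_of_pos (by positivity)).ne'
  simp only [besselCoeff]
  simp only [CharP.cast_eq_zero, zero_add, div_self this]
  simp

/-- Coefficient form of the classical relation `J_ν + J_{ν+2} = (2(ν+1)/t) J_{ν+1}`. In this
normalization it contains no division by `t`, and it plays the role of the Bessel equation
throughout. -/
theorem besselCoeff_recurrence {v : ℝ} (hv : 0 < v) (m : ℕ) :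
    besselCoeff v (m + 1) = besselCoeff (v + 1) (m + 1)
      - 1 / ((2 * v + 1) * (2 * v + 3)) * besselCoeff (v + 2) m := by
  have e1 := besselCoeff_succ hv m
  have e2 := besselCoeff_succ (by positivity : 0 < v + 1) m
  have h12 : v + 1 + 1 = v + 2 := by ring
  rw [h12] at e2
  have hrat : besselCoeff (v + 1) m * (1 / (2 * v + 1)) =
      besselCoeff (v + 2) m * ((2 * m + 2 * v + 3) / ((2 * v + 1) * (2 * v + 3))) := by
    have hp : (0 : ℝ) < v + 1 / 2 := by positivity
    have hp' : (0 : ℝ) < m + (v + 1) + 1 / 2 := by positivity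
    have hG : Gamma (m + (v + 1) + 1 / 2) ≠ 0 := (Gamma_pos_of_pos hp').ne'
    have h1 : v + 2 + 1 / 2 = (v + 1 + 1 / 2) + 1 := by ring
    have h2 : (m : ℝ) + (v + 2) + 1 / 2 = (m + (v + 1) + 1 / 2) + 1 := by ring
    have hf : (m.factorial : ℝ) ≠ 0 := by exact_mod_cast m.factorial_ne_zero
    rw [besselCoeff, besselCoeff, h1, h2, Gamma_add_one (by positivity), Gamma_add_one hp'.ne']
    field_simp
    ring
  have hm : (2 * ((m : ℝ) + 1)) ≠ 0 := by positivity
  apply mul_left_cancel₀ hm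
  rw [mul_sub, e1, e2, neg_mul, mul_comm (1 / (2 * v + 1)), hrat]
  have h3 : (2 * (v + 1) + 1) = 2 * v + 3 := by ring
  rw [h3]
  field_simp
  ring

theorem normalizedBessel_zero {v : ℝ} (hv : 0 < v) : normalizedBessel (v - 1 / 2) 0 = 1 := by
  rw [normalizedBessel_eq_tsum, tsum_eq_single 0]
  · simp [besselCoeff_zero hv]
  · intro m hm
    simp [hm]

theorem normalizedBessel_neg (ν t : ℝ) : normalizedBessel ν (-t) = normalizedBessel ν t := by
  simp only [normalizedBessel, pow_mul, neg_div, neg_sq]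

theorem normalizedBessel_abs (ν t : ℝ) : normalizedBessel ν |t| = normalizedBessel ν t := by
  rcases abs_choice t with h | h <;> rw [h]
  exact normalizedBessel_neg ν t

theorem normalizedBessel_recurrence {v : ℝ} (hv : 0 < v) (t : ℝ) :
    normalizedBessel (v - 1 / 2) t = normalizedBessel (v + 1 - 1 / 2) t
      - t ^ 2 / ((2 * v + 1) * (2 * v + 3)) * normalizedBessel (v + 2 - 1 / 2) t := by
  have hv1 : 0 < v + 1 := by positivity
  have hv2 : 0 < v + 2 := by positivity
  simp only [normalizedBessel_eq_tsum]
  rw [(summable_besselCoeff hv t).tsum_eq_zero_add, (summable_besselCoeff hv1 t).tsum_eq_zero_add,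
    besselCoeff_zero hv, besselCoeff_zero hv1, ← tsum_mul_left, add_sub_assoc,
    ← Summable.tsum_sub ((summable_nat_add_iff 1).mpr (summable_besselCoeff hv1 t))
      ((summable_besselCoeff hv2 t).mul_left _)]
  congr 2 with m
  rw [besselCoeff_recurrence hv]
  ring

/-- Termwise differentiation on `(-R, R)` with `R > |t|`, dominated by an exponential series. The
constant term is split off so that the derivative of the term `m + 1` matches the coefficient `m` of
the next order. -/
theorem hasDerivAt_normalizedBessel {v : ℝ} (hv : 0 < v) (t : ℝ) :
    HasDerivAt (normalizedBessel (v - 1 / 2))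
      (-(t / (2 * v + 1)) * normalizedBessel (v + 1 - 1 / 2) t) t := by
  have hv1 : 0 < v + 1 := by positivity
  have hfun : normalizedBessel (v - 1 / 2) =
      fun t => 1 + ∑' m, besselCoeff v (m + 1) * t ^ (2 * (m + 1)) := by
    ext s
    rw [normalizedBessel_eq_tsum, (summable_besselCoeff hv s).tsum_eq_zero_add,
      besselCoeff_zero hv]
    simp
  obtain ⟨R, hR⟩ : ∃ R, |t| < R := exists_gt _
  have hRt : t ∈ Ioo (-R) R := abs_lt.mp hR
  have hR0 : 0 < R := (abs_nonneg t).trans_lt hR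
  have key : HasDerivAt (fun t => ∑' m, besselCoeff v (m + 1) * t ^ (2 * (m + 1)))
      (∑' m, -(t / (2 * v + 1)) * (besselCoeff (v + 1) m * t ^ (2 * m))) t := by
    refine hasDerivAt_tsum_of_isPreconnected
      (u := fun m => R / (2 * v + 1) * (2 * ((1 / 4 * R ^ 2) ^ m / m.factorial)))
      (((Real.summable_pow_div_factorial (1 / 4 * R ^ 2)).mul_left 2).mul_left _)
      isOpen_Ioo isPreconnected_Ioo
      (g' := fun m s => -(s / (2 * v + 1)) * (besselCoeff (v + 1) m * s ^ (2 * m)))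
      (fun m s _ => ?_) (fun m s hs => ?_) hRt
      ((summable_nat_add_iff 1).mpr (summable_besselCoeff hv t)) hRt
    · convert! (hasDerivAt_pow (2 * (m + 1)) s).const_mul (besselCoeff v (m + 1)) using 1
      have h := besselCoeff_succ hv m
      have h2 : 2 * (m + 1) - 1 = 2 * m + 1 := by omega
      rw [h2]
      push_cast
      rw [pow_succ]
      linear_combination -(s ^ (2 * m) * s) * h
    · have hs' : |s| ≤ R := (abs_lt.mpr hs).le
      rw [norm_mul, norm_neg, norm_div, norm_mul, norm_pow, norm_eq_abs, norm_eq_abs, norm_eq_abs,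
        abs_of_pos (by positivity : 0 < 2 * v + 1)]
      refine mul_le_mul (div_le_div_of_nonneg_right hs' (by positivity)) ?_ (by positivity)
        (by positivity)
      rw [pow_mul]
      have : |s| ^ 2 ≤ R ^ 2 := by gcongr
      calc |besselCoeff (v + 1) m| * (|s| ^ 2) ^ m
          ≤ (2 * ((1 / 4) ^ m / m.factorial)) * (R ^ 2) ^ m := by
            gcongr
            exact abs_besselCoeff_le hv1 m
        _ = _ := by rw [mul_pow]; ring
  rw [hfun]
  rw [tsum_mul_left, ← normalizedBessel_eq_tsum] at key
  exact key.const_add 1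

theorem differentiable_normalizedBessel {v : ℝ} (hv : 0 < v) :
    Differentiable ℝ (normalizedBessel (v - 1 / 2)) :=
  fun t => (hasDerivAt_normalizedBessel hv t).differentiableAt

theorem continuous_normalizedBessel {v : ℝ} (hv : 0 < v) :
    Continuous (normalizedBessel (v - 1 / 2)) :=
  (differentiable_normalizedBessel hv).continuous

/-- Energy argument: `e = j² + (j')²` has derivative `-(4v/s)(j')²` by the Bessel equation, so it
decreases on `[0, ∞)` from `e(0) = 1`; evenness covers negative `t`. Writing `j'` through `j₁`
avoids dividing by `s` at the origin. -/
theorem abs_normalizedBessel_le_one {v : ℝ} (hv : 0 < v) (t : ℝ) :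
    |normalizedBessel (v - 1 / 2) t| ≤ 1 := by
  have hv1 : 0 < v + 1 := by positivity
  set j := normalizedBessel (v - 1 / 2) with hj
  set j₁ := normalizedBessel (v + 1 - 1 / 2) with hj₁
  set j₂ := normalizedBessel (v + 2 - 1 / 2) with hj₂
  let e : ℝ → ℝ := fun s => j s ^ 2 + (s / (2 * v + 1) * j₁ s) ^ 2
  have hd : ∀ s, HasDerivAt e (-(4 * v * s / (2 * v + 1) ^ 2 * j₁ s ^ 2)) s := by
    intro s
    have h0 := hasDerivAt_normalizedBessel hv s
    have h1 := hasDerivAt_normalizedBessel hv1 s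
    rw [show v + 1 + 1 = v + 2 by ring, show 2 * (v + 1) + 1 = 2 * v + 3 by ring] at h1
    have h2 := (h0.pow 2).add ((((hasDerivAt_id s).div_const (2 * v + 1)).mul h1).pow 2)
    refine h2.congr_deriv ?_
    have hr := normalizedBessel_recurrence hv s
    simp only [← hj, ← hj₁, ← hj₂] at hr ⊢
    simp only [id, Pi.mul_apply, Nat.add_one_sub_one, pow_one, Nat.cast_ofNat]
    rw [hr]
    have hn1 : 2 * v + 1 ≠ 0 := by positivity
    have hn3 : 2 * v + 3 ≠ 0 := by positivity
    field_simp
    ring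
  have hanti : AntitoneOn e (Ici 0) := by
    refine antitoneOn_of_deriv_nonpos (convex_Ici 0)
      (fun s _ => (hd s).continuousAt.continuousWithinAt)
      (fun s _ => (hd s).differentiableAt.differentiableWithinAt) fun s hs => ?_
    rw [interior_Ici] at hs
    have hs' : (0 : ℝ) < s := hs
    rw [(hd s).deriv, neg_nonpos]
    positivity
  have h := hanti (mem_Ici.mpr le_rfl) (mem_Ici.mpr (abs_nonneg t)) (abs_nonneg t)
  simp only [e, hj, normalizedBessel_zero hv, zero_div, zero_mul] at h
  rw [normalizedBessel_abs] at h
  rw [← sq_le_one_iff_abs_le_one]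
  nlinarith [sq_nonneg (|t| / (2 * v + 1) * j₁ |t|)]

/-- The Fourier–Bessel integral of a Gaussian in one variable. -/
theorem integral_gaussian_mul_normalizedBessel {v b : ℝ} (hv : 0 < v) (hb : 0 < b) (x : ℝ) :
    ∫ y in Ioi (0 : ℝ), exp (-b * y ^ 2 / 2) * (normalizedBessel (v - 1 / 2) (x * y) * y ^ (2 * v))
      = 2 ^ (v - 1 / 2) * Gamma (v + 1 / 2) * (b ^ (-(v + 1 / 2)) * exp (-x ^ 2 / (2 * b))) := by
  have hint : ∀ m : ℕ, ∫ y in Ioi (0 : ℝ), y ^ (2 * m + 2 * v) * exp (-(b / 2) * y ^ (2 : ℝ)) =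
      (b / 2) ^ (-(m + v + 1 / 2)) * (1 / 2) * Gamma (m + v + 1 / 2) := by
    intro m
    rw [integral_rpow_mul_exp_neg_mul_rpow two_pos
      (by have : (0 : ℝ) ≤ m := by positivity
          linarith) (by positivity)]
    congr 3 <;> ring
  have hintegrable : ∀ m : ℕ, IntegrableOn
      (fun y : ℝ => y ^ (2 * m + 2 * v) * exp (-(b / 2) * y ^ (2 : ℝ))) (Ioi 0) := by
    intro m
    -- The integral of a non-integrable function is zero by convention, whereas the value just
    -- computed is positive.
    by_contra h
    have h0 := integral_undef h
    rw [hint] at h0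
    have : 0 < Gamma (m + v + 1 / 2) := Gamma_pos_of_pos (by positivity)
    have : 0 < (b / 2) ^ (-(m + v + 1 / 2)) * (1 / 2) * Gamma (m + v + 1 / 2) := by positivity
    exact this.ne' h0
  let F : ℕ → ℝ → ℝ := fun m y =>
    besselCoeff v m * x ^ (2 * m) * (y ^ (2 * m + 2 * v) * exp (-(b / 2) * y ^ (2 : ℝ)))
  have hF : ∀ m, Integrable (F m) (volume.restrict (Ioi 0)) := fun m => (hintegrable m).const_mul _
  set A := 2 ^ (v - 1 / 2) * Gamma (v + 1 / 2) * b ^ (-(v + 1 / 2)) with hA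
  -- The Gamma factor of the moment cancels the one in the coefficient, leaving the general term of
  -- an exponential series.
  have hval : ∀ m, besselCoeff v m * x ^ (2 * m) *
      ((b / 2) ^ (-(m + v + 1 / 2)) * (1 / 2) * Gamma (m + v + 1 / 2)) =
        A * ((-x ^ 2 / (2 * b)) ^ m / m.factorial) := by
    intro m
    have hG : Gamma (m + v + 1 / 2) ≠ 0 := (Gamma_pos_of_pos (by positivity)).ne'
    have hf : (m.factorial : ℝ) ≠ 0 := by exact_mod_cast m.factorial_ne_zero
    have h2 : (b / 2) ^ (-(m + v + 1 / 2)) * (1 / 2) =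
        (2 / b) ^ m * (2 ^ (v - 1 / 2) * b ^ (-(v + 1 / 2))) := by
      rw [show -((m : ℝ) + v + 1 / 2) = -(m : ℝ) + (-(v + 1 / 2)) by ring,
        rpow_add (by positivity), rpow_neg (by positivity), rpow_natCast, ← inv_pow, inv_div,
        div_rpow hb.le two_pos.le, rpow_neg two_pos.le,
        show v + 1 / 2 = (v - 1 / 2) + 1 by ring, rpow_add two_pos, rpow_one, div_inv_eq_mul]
      ring
    rw [h2, hA, besselCoeff, show -x ^ 2 / (2 * b) = (-1) * x ^ 2 * (2 * b)⁻¹ by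
      rw [div_eq_mul_inv]; ring, mul_pow, mul_pow, div_pow, pow_mul, inv_pow, mul_pow,
      show (4 : ℝ) = 2 * 2 by norm_num, mul_pow]
    field_simp
  -- Absolute values only remove the alternating sign, so the norms sum to the exponential at
  -- `+x²/(2b)`; this justifies exchanging sum and integral.
  have hnorm : ∀ m, ∫ y in Ioi (0 : ℝ), ‖F m y‖ = A * ((x ^ 2 / (2 * b)) ^ m / m.factorial) := by
    intro m
    have : ∀ y ∈ Ioi (0 : ℝ), ‖F m y‖ = |besselCoeff v m * x ^ (2 * m)| *
        (y ^ (2 * m + 2 * v) * exp (-(b / 2) * y ^ (2 : ℝ))) := by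
      intro y hy
      have hy' : (0 : ℝ) < y := hy
      rw [norm_mul, norm_eq_abs, norm_eq_abs, abs_of_pos (a := _ * exp _) (by positivity)]
    rw [setIntegral_congr_fun measurableSet_Ioi this, integral_const_mul, hint]
    have hpos : 0 < (b / 2) ^ (-(m + v + 1 / 2)) * (1 / 2) * Gamma (m + v + 1 / 2) := by
      have : 0 < Gamma (m + v + 1 / 2) := Gamma_pos_of_pos (by positivity)
      positivity
    rw [← abs_of_pos hpos, ← abs_mul, hval]
    have hA0 : 0 < A := by
      have : 0 < Gamma (v + 1 / 2) := Gamma_pos_of_pos (by positivity)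
      positivity
    rw [abs_mul, abs_of_pos hA0, abs_div, abs_pow, abs_div, abs_neg,
      abs_of_nonneg (sq_nonneg x), abs_of_pos (by positivity : 0 < 2 * b), Nat.abs_cast]
  have hsum : Summable fun m => ∫ y in Ioi (0 : ℝ), ‖F m y‖ := by
    simp only [hnorm]
    exact (Real.summable_pow_div_factorial _).mul_left _
  have h := hasSum_integral_of_summable_integral_norm hF hsum
  have h1 : ∀ m, ∫ y in Ioi (0 : ℝ), F m y = A * ((-x ^ 2 / (2 * b)) ^ m / m.factorial) := by
    intro m
    rw [integral_const_mul, hint, hval]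
  simp only [h1] at h
  have h2 : ∑' m : ℕ, A * ((-x ^ 2 / (2 * b)) ^ m / m.factorial) =
      A * exp (-x ^ 2 / (2 * b)) := by
    rw [tsum_mul_left, Real.exp_eq_exp_ℝ, NormedSpace.exp_eq_tsum_div]
  rw [← mul_assoc, ← hA, ← h2, h.tsum_eq]
  refine setIntegral_congr_fun measurableSet_Ioi fun y hy => ?_
  have hy' : (0 : ℝ) < y := hy
  simp only [F]
  rw [normalizedBessel_eq_tsum, ← tsum_mul_right, ← tsum_mul_left]
  congr 1 with m
  rw [rpow_add hy', show (2 : ℝ) * m = ((2 * m : ℕ) : ℝ) by push_cast; ring, rpow_natCast, rpow_two,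
    mul_pow, show -b * y ^ 2 / 2 = -(b / 2) * y ^ 2 by ring]
  ring

/-! ### A criterion for continuity into the Schwartz space. -/

/-- A set of maps from a topological vector space to functions on `ℝⁿ` which are bounded by
continuous seminorms and differentiable, and whose span is stable under multiplication by the
coordinates and under partial derivatives. -/
structure IsSchwartzFamily {n : ℕ} {V : Type*} [AddCommGroup V] [Module ℂ V] [TopologicalSpace V]
    (G : Set (V → EuclideanSpace ℝ (Fin n) → ℂ)) : Prop where
  bound : ∀ T ∈ G, ∃ p : Seminorm ℂ V, Continuous p ∧ ∀ φ x, ‖T φ x‖ ≤ p φ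
  differentiable : ∀ T ∈ G, ∀ φ, Differentiable ℝ (T φ)
  coord_mul : ∀ T ∈ G, ∀ j, (fun φ x => (x j : ℂ) * T φ x) ∈ Submodule.span ℂ G
  partialDeriv : ∀ T ∈ G, ∀ j,
    (fun φ x => fderiv ℝ (T φ) x (EuclideanSpace.single j 1)) ∈ Submodule.span ℂ G

namespace IsSchwartzFamily

variable {n : ℕ} {V : Type*} [AddCommGroup V] [Module ℂ V] [TopologicalSpace V]
  {G : Set (V → EuclideanSpace ℝ (Fin n) → ℂ)}

theorem differentiable_span (hG : IsSchwartzFamily G) {T : V → EuclideanSpace ℝ (Fin n) → ℂ}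
    (hT : T ∈ Submodule.span ℂ G) (φ : V) : Differentiable ℝ (T φ) := by
  induction hT using Submodule.span_induction with
  | mem T h => exact hG.differentiable T h φ
  | zero => exact differentiable_const 0
  | add S T _ _ h₁ h₂ => exact h₁.add h₂
  | smul a T _ h => exact h.const_smul a

theorem bound_span (hG : IsSchwartzFamily G) {T : V → EuclideanSpace ℝ (Fin n) → ℂ}
    (hT : T ∈ Submodule.span ℂ G) :
    ∃ p : Seminorm ℂ V, Continuous p ∧ ∀ φ x, ‖T φ x‖ ≤ p φ := by
  induction hT using Submodule.span_induction with
  | mem T h => exact hG.bound T h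
  | zero => exact ⟨0, continuous_const, by simp⟩
  | add S T _ _ h₁ h₂ =>
    obtain ⟨p, hp, h₁⟩ := h₁
    obtain ⟨q, hq, h₂⟩ := h₂
    exact ⟨p + q, hp.add hq, fun φ x => (norm_add_le _ _).trans (add_le_add (h₁ φ x) (h₂ φ x))⟩
  | smul a T _ h =>
    obtain ⟨p, hp, h⟩ := h
    refine ⟨‖a‖₊ • p, hp.const_smul ‖a‖₊, fun φ x => ?_⟩
    simp only [Pi.smul_apply, norm_smul]
    exact mul_le_mul_of_nonneg_left (h φ x) (norm_nonneg a)

theorem coord_mul_span (hG : IsSchwartzFamily G) {T : V → EuclideanSpace ℝ (Fin n) → ℂ}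
    (hT : T ∈ Submodule.span ℂ G) (j : Fin n) :
    (fun φ x => (x j : ℂ) * T φ x) ∈ Submodule.span ℂ G := by
  induction hT using Submodule.span_induction with
  | mem T h => exact hG.coord_mul T h j
  | zero => convert Submodule.zero_mem _ using 1; ext; simp
  | add S T _ _ h₁ h₂ => convert Submodule.add_mem _ h₁ h₂ using 1; ext; simp [mul_add]
  | smul a T _ h => convert Submodule.smul_mem _ a h using 1; ext; simp [mul_left_comm]

theorem partialDeriv_span (hG : IsSchwartzFamily G) {T : V → EuclideanSpace ℝ (Fin n) → ℂ}
    (hT : T ∈ Submodule.span ℂ G) (j : Fin n) :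
    (fun φ x => fderiv ℝ (T φ) x (EuclideanSpace.single j 1)) ∈ Submodule.span ℂ G := by
  induction hT using Submodule.span_induction with
  | mem T h => exact hG.partialDeriv T h j
  | zero =>
    convert Submodule.zero_mem _ using 1
    ext φ x
    rw [show (0 : V → EuclideanSpace ℝ (Fin n) → ℂ) φ = fun _ => 0 from rfl]
    simp
  | add S T hS hT h₁ h₂ =>
    convert Submodule.add_mem _ h₁ h₂ using 1
    ext φ x
    simp only [Pi.add_apply]
    rw [fderiv_add (hG.differentiable_span hS φ x) (hG.differentiable_span hT φ x)]
    simp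
  | smul a T hT h =>
    convert Submodule.smul_mem _ a h using 1
    ext φ x
    simp only [Pi.smul_apply]
    rw [fderiv_const_smul (hG.differentiable_span hT φ x)]
    simp

theorem norm_le_sum_abs (x : EuclideanSpace ℝ (Fin n)) : ‖x‖ ≤ ∑ j, |x j| := by
  conv_lhs => rw [← (EuclideanSpace.basisFun (Fin n) ℝ).sum_repr x]
  refine (norm_sum_le _ _).trans (le_of_eq ?_)
  simp [norm_smul]

/-- Since `‖x‖ ≤ ∑ |xⱼ|`, each power of `‖x‖` can be traded for coordinate factors, which stay
inside the span. -/
theorem pow_mul_norm_le (hG : IsSchwartzFamily G) (k : ℕ) :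
    ∀ {T : V → EuclideanSpace ℝ (Fin n) → ℂ}, T ∈ Submodule.span ℂ G →
      ∃ p : Seminorm ℂ V, Continuous p ∧ ∀ φ x, ‖x‖ ^ k * ‖T φ x‖ ≤ p φ := by
  induction k with
  | zero => simpa using fun {T} hT => hG.bound_span (T := T) hT
  | succ k ih =>
    intro T hT
    choose p hp hle using fun j => ih (hG.coord_mul_span hT j)
    refine ⟨∑ j, p j, Seminorm.continuous_finsetSum fun j _ => hp j, fun φ x => ?_⟩
    calc ‖x‖ ^ (k + 1) * ‖T φ x‖ = ‖x‖ ^ k * (‖x‖ * ‖T φ x‖) := by ring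
      _ ≤ ‖x‖ ^ k * ((∑ j, |x j|) * ‖T φ x‖) := by
        gcongr
        exact norm_le_sum_abs x
      _ = ∑ j, ‖x‖ ^ k * ‖(x j : ℂ) * T φ x‖ := by
        simp [Finset.sum_mul, Finset.mul_sum]
      _ ≤ ∑ j, p j φ := Finset.sum_le_sum fun j _ => hle j φ x
      _ = (∑ j, p j) φ := by rw [_root_.sum_apply]

/-- The linear map `c ↦ (x ↦ c xⱼ)`. -/
def coordSmul (j : Fin n) : ℂ →L[ℝ] EuclideanSpace ℝ (Fin n) →L[ℝ] ℂ :=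
  ContinuousLinearMap.smulRightL ℝ (EuclideanSpace ℝ (Fin n)) ℂ (EuclideanSpace.proj j)

theorem fderiv_eq_sum (f : EuclideanSpace ℝ (Fin n) → ℂ) :
    fderiv ℝ f = fun x => ∑ j, coordSmul j (fderiv ℝ f x (EuclideanSpace.single j 1)) := by
  ext x y
  conv_lhs => rw [← (EuclideanSpace.basisFun (Fin n) ℝ).sum_repr y]
  simp [coordSmul]

/-- The Fréchet derivative is a sum of constant linear maps applied to partial derivatives, and
these lie in the span again. -/
theorem contDiff_span (hG : IsSchwartzFamily G) (m : ℕ) :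
    ∀ {T : V → EuclideanSpace ℝ (Fin n) → ℂ}, T ∈ Submodule.span ℂ G →
      ∀ φ, ContDiff ℝ m (T φ) := by
  induction m with
  | zero => exact fun hT φ => contDiff_zero.mpr (hG.differentiable_span hT φ).continuous
  | succ m ih =>
    intro T hT φ
    rw [Nat.cast_add, Nat.cast_one, contDiff_succ_iff_fderiv]
    refine ⟨hG.differentiable_span hT φ, by simp, ?_⟩
    rw [fderiv_eq_sum]
    exact ContDiff.sum fun j _ =>
      (coordSmul j).contDiff.comp (ih (hG.partialDeriv_span hT j) φ)

/-- Induction on the order of differentiation, lowering it by passing to partial derivatives, until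
only decay of elements of the span has to be shown. -/
theorem pow_mul_norm_iteratedFDeriv_le (hG : IsSchwartzFamily G) (k m : ℕ) :
    ∀ {T : V → EuclideanSpace ℝ (Fin n) → ℂ}, T ∈ Submodule.span ℂ G →
      ∃ p : Seminorm ℂ V, Continuous p ∧
        ∀ φ x, ‖x‖ ^ k * ‖iteratedFDeriv ℝ m (T φ) x‖ ≤ p φ := by
  induction m with
  | zero => simpa using fun {T} hT => hG.pow_mul_norm_le k (T := T) hT
  | succ m ih =>
    intro T hT
    choose p hp hle using fun j => ih (hG.partialDeriv_span hT j)
    refine ⟨∑ j, ‖(coordSmul j : ℂ →L[ℝ] EuclideanSpace ℝ (Fin n) →L[ℝ] ℂ)‖₊ • p j,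
      Seminorm.continuous_finsetSum fun j _ => (hp j).const_smul _, fun φ x => ?_⟩
    have hc : ∀ j : Fin n, ContDiff ℝ m
        (fun y => fderiv ℝ (T φ) y (EuclideanSpace.single j 1)) := fun j =>
      hG.contDiff_span m (hG.partialDeriv_span hT j) φ
    have h1 : ‖iteratedFDeriv ℝ (m + 1) (T φ) x‖ ≤
        ∑ j : Fin n, ‖(coordSmul j : ℂ →L[ℝ] EuclideanSpace ℝ (Fin n) →L[ℝ] ℂ)‖ *
        ‖iteratedFDeriv ℝ m (fun y => fderiv ℝ (T φ) y (EuclideanSpace.single j 1)) x‖ := by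
      have h2 : iteratedFDeriv ℝ m (fderiv ℝ (T φ)) x = ∑ j : Fin n, iteratedFDeriv ℝ m
          (coordSmul j ∘ fun y => fderiv ℝ (T φ) y (EuclideanSpace.single j 1)) x := by
        have h3 : fderiv ℝ (T φ) = ∑ j : Fin n,
            coordSmul j ∘ fun y => fderiv ℝ (T φ) y (EuclideanSpace.single j 1) := by
          refine (fderiv_eq_sum _).trans ?_
          ext1 y
          rw [Finset.sum_apply]
          rfl
        conv_lhs => rw [h3]
        exact iteratedFDeriv_sum_apply fun j _ => ((coordSmul j).contDiff.comp (hc j)).contDiffAt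
      rw [← norm_iteratedFDeriv_fderiv, h2]
      refine (norm_sum_le _ _).trans (Finset.sum_le_sum fun j _ => ?_)
      exact (coordSmul j).norm_iteratedFDeriv_comp_left (hc j).contDiffAt le_rfl
    calc ‖x‖ ^ k * ‖iteratedFDeriv ℝ (m + 1) (T φ) x‖
        ≤ ‖x‖ ^ k * ∑ j : Fin n,
            ‖(coordSmul j : ℂ →L[ℝ] EuclideanSpace ℝ (Fin n) →L[ℝ] ℂ)‖ *
            ‖iteratedFDeriv ℝ m (fun y => fderiv ℝ (T φ) y (EuclideanSpace.single j 1)) x‖ := by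
          gcongr
      _ = ∑ j : Fin n, ‖(coordSmul j : ℂ →L[ℝ] EuclideanSpace ℝ (Fin n) →L[ℝ] ℂ)‖ * (‖x‖ ^ k *
            ‖iteratedFDeriv ℝ m (fun y => fderiv ℝ (T φ) y (EuclideanSpace.single j 1)) x‖) := by
          rw [Finset.mul_sum]
          exact Finset.sum_congr rfl fun j _ => by ring
      _ ≤ ∑ j : Fin n, ‖(coordSmul j : ℂ →L[ℝ] EuclideanSpace ℝ (Fin n) →L[ℝ] ℂ)‖ * p j φ := by
          gcongr with j
          exact hle j φ x
      _ = _ := by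
          rw [_root_.sum_apply]
          rfl

/-- A linear map in the span of a Schwartz family takes values in the Schwartz space, and is
continuous. -/
theorem exists_clm [IsTopologicalAddGroup V] (hG : IsSchwartzFamily G)
    (T : V →ₗ[ℂ] EuclideanSpace ℝ (Fin n) → ℂ) (hT : (fun φ => T φ) ∈ Submodule.span ℂ G) :
    ∃ L : V →L[ℂ] 𝓢(EuclideanSpace ℝ (Fin n), ℂ), ∀ φ x, L φ x = T φ x := by
  let L₀ : V →ₗ[ℂ] 𝓢(EuclideanSpace ℝ (Fin n), ℂ) :=
    { toFun := fun φ =>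
        { toFun := T φ
          smooth' := contDiff_infty.mpr fun m => hG.contDiff_span m hT φ
          decay' := fun k m => by
            obtain ⟨p, -, h⟩ := hG.pow_mul_norm_iteratedFDeriv_le k m hT
            exact ⟨p φ, h φ⟩ }
      map_add' := fun φ ψ => by
        ext x
        simp only [map_add]
        rfl
      map_smul' := fun a φ => by
        ext x
        simp only [map_smul]
        rfl }
  refine ⟨⟨L₀, WithSeminorms.continuous_of_continuous_comp
    (schwartz_withSeminorms ℂ (EuclideanSpace ℝ (Fin n)) ℂ) L₀ fun i => ?_⟩, fun φ x => rfl⟩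
  obtain ⟨p, hp, h⟩ := hG.pow_mul_norm_iteratedFDeriv_le i.1 i.2 hT
  exact Seminorm.continuous_of_le hp fun φ =>
    SchwartzMap.seminorm_le_bound ℂ i.1 i.2 _ (apply_nonneg p φ) (h φ)

end IsSchwartzFamily

variable {n : ℕ}

/-! ### Partial derivatives and coordinates on the Schwartz space. -/

theorem hasTemperateGrowth_coord (j : Fin n) :
    Function.HasTemperateGrowth fun x : EuclideanSpace ℝ (Fin n) => (x j : ℂ) :=
  (Complex.ofRealCLM.comp (EuclideanSpace.proj j)).hasTemperateGrowth

/-- The partial derivative on the Schwartz space. -/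
def partialCLM (i : Fin n) :
    𝓢(EuclideanSpace ℝ (Fin n), ℂ) →L[ℂ] 𝓢(EuclideanSpace ℝ (Fin n), ℂ) :=
  LineDeriv.lineDerivOpCLM ℂ _ (EuclideanSpace.single i (1 : ℝ))

theorem partialCLM_apply (i : Fin n) (f : 𝓢(EuclideanSpace ℝ (Fin n), ℂ))
    (x : EuclideanSpace ℝ (Fin n)) :
    partialCLM i f x = fderiv ℝ f x (EuclideanSpace.single i 1) := rfl

theorem partialCLM_apply_eq_lineDeriv (i : Fin n) (f : 𝓢(EuclideanSpace ℝ (Fin n), ℂ))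
    (x : EuclideanSpace ℝ (Fin n)) :
    partialCLM i f x = lineDeriv ℝ f x (EuclideanSpace.single i 1) :=
  SchwartzMap.lineDerivOp_apply _ f x

theorem partialCLM_comm (i j : Fin n) (f : 𝓢(EuclideanSpace ℝ (Fin n), ℂ)) :
    partialCLM i (partialCLM j f) = partialCLM j (partialCLM i f) := by
  have h : ∀ (a b : Fin n) (x : EuclideanSpace ℝ (Fin n)), partialCLM a (partialCLM b f) x =
      fderiv ℝ (fderiv ℝ f) x (EuclideanSpace.single a 1) (EuclideanSpace.single b 1) := by
    intro a b x
    have hd : DifferentiableAt ℝ (fderiv ℝ f) x :=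
      ((f.smooth 2).fderiv_right (m := 1) (by norm_num)).differentiable (by norm_num) x
    rw [partialCLM_apply, show ⇑(partialCLM b f) =
      fun y => fderiv ℝ f y (EuclideanSpace.single b 1) from rfl]
    rw [fderiv_clm_apply hd (differentiableAt_const _)]
    simp
  ext x
  rw [h, h]
  exact ((f.smooth 2).contDiffAt.isSymmSndFDerivAt (by simp)) _ _

/-- Multiplication by a coordinate on the Schwartz space. -/
def coordCLM (i : Fin n) :
    𝓢(EuclideanSpace ℝ (Fin n), ℂ) →L[ℂ] 𝓢(EuclideanSpace ℝ (Fin n), ℂ) :=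
  SchwartzMap.smulLeftCLM ℂ fun x => (x i : ℂ)

theorem coordCLM_apply (i : Fin n) (f : 𝓢(EuclideanSpace ℝ (Fin n), ℂ))
    (x : EuclideanSpace ℝ (Fin n)) : coordCLM i f x = x i * f x :=
  SchwartzMap.smulLeftCLM_apply_apply (hasTemperateGrowth_coord i) f x

theorem hasFDerivAt_coord (i : Fin n) (x : EuclideanSpace ℝ (Fin n)) :
    HasFDerivAt (fun y : EuclideanSpace ℝ (Fin n) => (y i : ℂ))
      (Complex.ofRealCLM.comp (EuclideanSpace.proj i)) x :=
  (Complex.ofRealCLM.comp (EuclideanSpace.proj i)).hasFDerivAt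

theorem partialCLM_coordCLM {i j : Fin n} (h : j ≠ i) (f : 𝓢(EuclideanSpace ℝ (Fin n), ℂ)) :
    partialCLM i (coordCLM j f) = coordCLM j (partialCLM i f) := by
  ext x
  rw [coordCLM_apply, partialCLM_apply, partialCLM_apply,
    show ⇑(coordCLM j f) = fun y => (y j : ℂ) * f y from funext (coordCLM_apply j f),
    ((hasFDerivAt_coord j x).fun_mul (f.hasFDerivAt x)).fderiv]
  simp [h]

theorem partialCLM_pow_coordCLM {i j : Fin n} (h : j ≠ i) (m : ℕ)
    (f : 𝓢(EuclideanSpace ℝ (Fin n), ℂ)) :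
    (partialCLM i ^ m) (coordCLM j f) = coordCLM j ((partialCLM i ^ m) f) := by
  induction m generalizing f with
  | zero => rfl
  | succ m ih =>
    simp only [pow_succ, mul_apply_eq_comp, partialCLM_coordCLM h, ih]

theorem partialCLM_pow_comm (i j : Fin n) (m : ℕ) (f : 𝓢(EuclideanSpace ℝ (Fin n), ℂ)) :
    (partialCLM i ^ m) (partialCLM j f) = partialCLM j ((partialCLM i ^ m) f) := by
  induction m generalizing f with
  | zero => rfl
  | succ m ih =>
    simp only [pow_succ, mul_apply_eq_comp, partialCLM_comm i j, ih]

/-! ### Division of a Schwartz function by a coordinate. -/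

/-- The linear map that multiplies the `i`-th coordinate by `t`. -/
def scaleCoord (i : Fin n) (t : ℝ) : EuclideanSpace ℝ (Fin n) →L[ℝ] EuclideanSpace ℝ (Fin n) :=
  ContinuousLinearMap.id ℝ _ +
    (t - 1) • (EuclideanSpace.proj i).smulRight (EuclideanSpace.single i (1 : ℝ))

theorem scaleCoord_apply (i : Fin n) (t : ℝ) (x : EuclideanSpace ℝ (Fin n)) :
    scaleCoord i t x = x + ((t - 1) * x i) • EuclideanSpace.single i 1 := by
  simp [scaleCoord, smul_smul]

@[simp] theorem scaleCoord_apply_self (i : Fin n) (t : ℝ) (x : EuclideanSpace ℝ (Fin n)) :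
    scaleCoord i t x i = t * x i := by
  simp [scaleCoord_apply]
  ring

theorem scaleCoord_apply_ne {i j : Fin n} (h : j ≠ i) (t : ℝ) (x : EuclideanSpace ℝ (Fin n)) :
    scaleCoord i t x j = x j := by
  simp [scaleCoord_apply, h]

theorem scaleCoord_one (i : Fin n) (x : EuclideanSpace ℝ (Fin n)) : scaleCoord i 1 x = x := by
  simp [scaleCoord_apply]

theorem continuous_scaleCoord (i : Fin n) : Continuous (scaleCoord i) := by
  unfold scaleCoord
  fun_prop

theorem continuous_scaleCoord_apply (i : Fin n) (x : EuclideanSpace ℝ (Fin n)) :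
    Continuous fun t => scaleCoord i t x :=
  (continuous_scaleCoord i).clm_apply continuous_const

/-- The weighted mean `∫₀¹ tᵐ f(x₁, …, t xᵢ, …, xₙ) dt`. -/
def scaleMean (i : Fin n) (m : ℕ) (f : 𝓢(EuclideanSpace ℝ (Fin n), ℂ))
    (x : EuclideanSpace ℝ (Fin n)) : ℂ :=
  ∫ t in (0 : ℝ)..1, (t : ℂ) ^ m * f (scaleCoord i t x)

theorem continuous_scaleMean_integrand (i : Fin n) (m : ℕ)
    (f : 𝓢(EuclideanSpace ℝ (Fin n), ℂ)) (x : EuclideanSpace ℝ (Fin n)) :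
    Continuous fun t : ℝ => (t : ℂ) ^ m * f (scaleCoord i t x) :=
  (Complex.continuous_ofReal.pow m).mul (f.continuous.comp (continuous_scaleCoord_apply i x))

theorem norm_scaleMean_le (i : Fin n) (m : ℕ) (f : 𝓢(EuclideanSpace ℝ (Fin n), ℂ))
    (x : EuclideanSpace ℝ (Fin n)) : ‖scaleMean i m f x‖ ≤ SchwartzMap.seminorm ℂ 0 0 f := by
  have h := intervalIntegral.norm_integral_le_of_norm_le_const (a := (0 : ℝ)) (b := 1)
    (f := fun t : ℝ => (t : ℂ) ^ m * f (scaleCoord i t x))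
    (C := SchwartzMap.seminorm ℂ 0 0 f) fun t ht => ?_
  · simpa [scaleMean] using h
  · rw [uIoc_of_le zero_le_one] at ht
    rw [norm_mul, norm_pow, Complex.norm_real, norm_eq_abs, abs_of_pos ht.1]
    calc t ^ m * ‖f (scaleCoord i t x)‖ ≤ 1 * ‖f (scaleCoord i t x)‖ := by
          gcongr
          exact pow_le_one₀ ht.1.le ht.2
      _ ≤ _ := by
          rw [one_mul]
          exact SchwartzMap.norm_le_seminorm ℂ f _

theorem scaleMean_add (i : Fin n) (m : ℕ) (f g : 𝓢(EuclideanSpace ℝ (Fin n), ℂ)) :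
    scaleMean i m (f + g) = scaleMean i m f + scaleMean i m g := by
  ext x
  simp only [scaleMean, Pi.add_apply]
  rw [← intervalIntegral.integral_add
    ((continuous_scaleMean_integrand i m f x).intervalIntegrable _ _)
    ((continuous_scaleMean_integrand i m g x).intervalIntegrable _ _)]
  simp [mul_add]

theorem scaleMean_smul (i : Fin n) (m : ℕ) (c : ℂ) (f : 𝓢(EuclideanSpace ℝ (Fin n), ℂ)) :
    scaleMean i m (c • f) = c • scaleMean i m f := by
  ext x
  simp only [scaleMean, Pi.smul_apply, smul_eq_mul]
  rw [← intervalIntegral.integral_const_mul]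
  simp [mul_left_comm]

/-- Differentiation under the integral sign. The integrability conjunct is what allows the
operator-valued integral to be evaluated at a vector afterwards. -/
theorem hasFDerivAt_scaleMean (i : Fin n) (m : ℕ) (f : 𝓢(EuclideanSpace ℝ (Fin n), ℂ))
    (x : EuclideanSpace ℝ (Fin n)) :
    HasFDerivAt (scaleMean i m f)
      (∫ t in (0 : ℝ)..1, (t : ℂ) ^ m • (fderiv ℝ f (scaleCoord i t x)).comp (scaleCoord i t)) x ∧
    IntervalIntegrable (fun t : ℝ =>
      (t : ℂ) ^ m • (fderiv ℝ f (scaleCoord i t x)).comp (scaleCoord i t)) volume 0 1 := by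
  have hf' : Continuous (fderiv ℝ f) := (f.smooth 1).continuous_fderiv (by simp)
  have hc : ∀ x, Continuous fun t : ℝ =>
      (t : ℂ) ^ m • (fderiv ℝ f (scaleCoord i t x)).comp (scaleCoord i t) := fun x =>
    (Complex.continuous_ofReal.pow m).smul
      ((hf'.comp (continuous_scaleCoord_apply i x)).clm_comp (continuous_scaleCoord i))
  have hbound : Continuous fun t : ℝ =>
      |t| ^ m * (SchwartzMap.seminorm ℂ 0 1 f * ‖scaleCoord i t‖) :=
    (continuous_abs.pow m).mul (continuous_const.mul (continuous_scaleCoord i).norm)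
  refine ⟨intervalIntegral.hasFDerivAt_integral_of_dominated_of_fderiv_le
    (F := fun y t => (t : ℂ) ^ m * f (scaleCoord i t y))
    (F' := fun y t => (t : ℂ) ^ m • (fderiv ℝ f (scaleCoord i t y)).comp (scaleCoord i t))
    (bound := fun t => |t| ^ m * (SchwartzMap.seminorm ℂ 0 1 f * ‖scaleCoord i t‖))
    univ_mem (Eventually.of_forall fun y =>
      (continuous_scaleMean_integrand i m f y).aestronglyMeasurable)
    ((continuous_scaleMean_integrand i m f x).intervalIntegrable _ _)
    (hc x).aestronglyMeasurable (Eventually.of_forall fun t _ y _ => ?_)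
    (hbound.intervalIntegrable _ _) (Eventually.of_forall fun t _ y _ => ?_),
    (hc x).intervalIntegrable _ _⟩
  · rw [norm_smul, norm_pow, Complex.norm_real, norm_eq_abs]
    refine mul_le_mul_of_nonneg_left ?_ (by positivity)
    refine (ContinuousLinearMap.opNorm_comp_le _ _).trans
      (mul_le_mul_of_nonneg_right ?_ (norm_nonneg _))
    rw [← norm_iteratedFDeriv_one]
    exact SchwartzMap.norm_iteratedFDeriv_le_seminorm ℂ f 1 _
  · exact ((f.hasFDerivAt _).comp y (scaleCoord i t).hasFDerivAt).const_mul _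

theorem fderiv_scaleMean_self (i : Fin n) (m : ℕ) (f : 𝓢(EuclideanSpace ℝ (Fin n), ℂ))
    (x : EuclideanSpace ℝ (Fin n)) :
    fderiv ℝ (scaleMean i m f) x (EuclideanSpace.single i 1) =
      scaleMean i (m + 1) (partialCLM i f) x := by
  obtain ⟨h, hi⟩ := hasFDerivAt_scaleMean i m f x
  rw [h.fderiv, ContinuousLinearMap.intervalIntegral_apply hi]
  refine intervalIntegral.integral_congr fun t _ => ?_
  have hs : scaleCoord i t (EuclideanSpace.single i 1) = t • EuclideanSpace.single i 1 := by
    rw [scaleCoord_apply]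
    simp only [PiLp.single_apply, if_true, mul_one]
    rw [sub_smul, one_smul, add_sub_cancel]
  simp only [_root_.smul_apply, ContinuousLinearMap.comp_apply, hs, map_smul,
    partialCLM_apply, pow_succ, smul_eq_mul, Complex.real_smul]
  ring

theorem fderiv_scaleMean_ne {i j : Fin n} (hj : j ≠ i) (m : ℕ)
    (f : 𝓢(EuclideanSpace ℝ (Fin n), ℂ)) (x : EuclideanSpace ℝ (Fin n)) :
    fderiv ℝ (scaleMean i m f) x (EuclideanSpace.single j 1) =
      scaleMean i m (partialCLM j f) x := by
  obtain ⟨h, hi⟩ := hasFDerivAt_scaleMean i m f x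
  rw [h.fderiv, ContinuousLinearMap.intervalIntegral_apply hi]
  refine intervalIntegral.integral_congr fun t _ => ?_
  have hs : scaleCoord i t (EuclideanSpace.single j 1) = EuclideanSpace.single j 1 := by
    rw [scaleCoord_apply]
    simp [hj.symm]
  simp only [_root_.smul_apply, ContinuousLinearMap.comp_apply, hs, partialCLM_apply,
    smul_eq_mul]

theorem coord_mul_scaleMean_ne {i j : Fin n} (hj : j ≠ i) (m : ℕ)
    (f : 𝓢(EuclideanSpace ℝ (Fin n), ℂ)) (x : EuclideanSpace ℝ (Fin n)) :
    (x j : ℂ) * scaleMean i m f x = scaleMean i m (coordCLM j f) x := by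
  rw [scaleMean, ← intervalIntegral.integral_const_mul]
  refine intervalIntegral.integral_congr fun t _ => ?_
  simp only [coordCLM_apply, scaleCoord_apply_ne hj]
  ring

theorem hasDerivAt_comp_scaleCoord (i : Fin n) (f : 𝓢(EuclideanSpace ℝ (Fin n), ℂ))
    (x : EuclideanSpace ℝ (Fin n)) (t : ℝ) :
    HasDerivAt (fun s => f (scaleCoord i s x)) (x i * partialCLM i f (scaleCoord i t x)) t := by
  have h1 : HasDerivAt (fun s => scaleCoord i s x) (x i • EuclideanSpace.single i (1 : ℝ)) t := by
    simp only [scaleCoord_apply]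
    have := ((((hasDerivAt_id t).sub_const 1).mul_const (x i)).smul_const
      (EuclideanSpace.single i (1 : ℝ))).const_add x
    simpa using this
  have := (f.hasFDerivAt (scaleCoord i t x)).comp_hasDerivAt t h1
  rw [map_smul, Complex.real_smul] at this
  exact this

/-- Hadamard's lemma: the fundamental theorem of calculus along `t ↦ scaleCoord i t x`. -/
theorem coord_mul_scaleMean_zero (i : Fin n) (f : 𝓢(EuclideanSpace ℝ (Fin n), ℂ))
    (x : EuclideanSpace ℝ (Fin n)) :
    (x i : ℂ) * scaleMean i 0 (partialCLM i f) x = f x - f (scaleCoord i 0 x) := by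
  have hc : Continuous fun t => (x i : ℂ) * partialCLM i f (scaleCoord i t x) :=
    continuous_const.mul ((partialCLM i f).continuous.comp (continuous_scaleCoord_apply i x))
  have h := intervalIntegral.integral_eq_sub_of_hasDerivAt (a := 0) (b := 1)
    (fun t _ => hasDerivAt_comp_scaleCoord i f x t) (hc.intervalIntegrable _ _)
  rw [scaleCoord_one] at h
  rw [← h, scaleMean, ← intervalIntegral.integral_const_mul]
  simp

/-- Integration of the derivative of `t ^ (m + 1) * f (scaleCoord i t x)` over `[0, 1]`. -/
theorem coord_mul_scaleMean_succ (i : Fin n) (m : ℕ) (f : 𝓢(EuclideanSpace ℝ (Fin n), ℂ))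
    (x : EuclideanSpace ℝ (Fin n)) :
    (x i : ℂ) * scaleMean i (m + 1) (partialCLM i f) x = f x - (m + 1) * scaleMean i m f x := by
  have hc1 := (continuous_scaleMean_integrand i m f x).const_mul ((m : ℂ) + 1)
  have hc2 := (continuous_scaleMean_integrand i (m + 1) (partialCLM i f) x).const_mul (x i : ℂ)
  have h := intervalIntegral.integral_eq_sub_of_hasDerivAt (a := 0) (b := 1)
    (f := fun t : ℝ => (t : ℂ) ^ (m + 1) * f (scaleCoord i t x))
    (f' := fun t : ℝ => ((m : ℂ) + 1) * ((t : ℂ) ^ m * f (scaleCoord i t x)) +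
      x i * ((t : ℂ) ^ (m + 1) * partialCLM i f (scaleCoord i t x)))
    (fun t _ => ?_) ((hc1.add hc2).intervalIntegrable _ _)
  · rw [intervalIntegral.integral_add (hc1.intervalIntegrable _ _) (hc2.intervalIntegrable _ _),
      intervalIntegral.integral_const_mul, intervalIntegral.integral_const_mul] at h
    simp only [scaleCoord_one, Complex.ofReal_one, one_pow, one_mul, Complex.ofReal_zero, ne_eq,
      Nat.add_eq_zero_iff, one_ne_zero, and_false, not_false_eq_true, zero_pow, zero_mul,
      sub_zero] at h
    rw [← h, scaleMean, scaleMean]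
    ring
  · have h1 : HasDerivAt (fun t : ℝ => (t : ℂ) ^ (m + 1)) (((m : ℂ) + 1) * (t : ℂ) ^ m) t := by
      simpa using ((hasDerivAt_id t).ofReal_comp.fun_pow (m + 1))
    refine (h1.mul (hasDerivAt_comp_scaleCoord i f x t)).congr_deriv ?_
    ring

/-- The Schwartz family of the means of derivatives of functions that vanish for `xᵢ = 0`. -/
def meanFamily (V : Type*) [AddCommGroup V] [Module ℂ V] [TopologicalSpace V] (i : Fin n) :
    Set (V → EuclideanSpace ℝ (Fin n) → ℂ) :=
  {T | ∃ L : V →L[ℂ] 𝓢(EuclideanSpace ℝ (Fin n), ℂ), T = fun φ x => L φ x} ∪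
  {T | ∃ (m : ℕ) (L : V →L[ℂ] 𝓢(EuclideanSpace ℝ (Fin n), ℂ)),
    (∀ φ x, x i = 0 → L φ x = 0) ∧
      T = fun φ x => scaleMean i m ((partialCLM i ^ (m + 1)) (L φ)) x}

theorem continuous_schwartz_seminorm (k m : ℕ) :
    Continuous (SchwartzMap.seminorm ℂ k m :
      Seminorm ℂ 𝓢(EuclideanSpace ℝ (Fin n), ℂ)) :=
  (schwartz_withSeminorms ℂ (EuclideanSpace ℝ (Fin n)) ℂ).continuous_seminorm (k, m)

/-- For `f` vanishing on `xᵢ = 0`, the mean of `∂ᵢ^(m+1) f` with weight `t^m` is the `m`-th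
derivative in `xᵢ` of `f / xᵢ`. So `∂ᵢ` raises `m`, while multiplication by `xᵢ` lowers it up to a
Schwartz function; at `m = 0` it returns `f`, and this is where the vanishing is used. Other
variables commute with the mean. -/
theorem isSchwartzFamily_meanFamily (V : Type*) [AddCommGroup V] [Module ℂ V]
    [TopologicalSpace V] (i : Fin n) : IsSchwartzFamily (meanFamily V i) where
  bound := by
    rintro T (⟨L, rfl⟩ | ⟨m, L, -, rfl⟩)
    · exact ⟨(SchwartzMap.seminorm ℂ 0 0 : Seminorm ℂ 𝓢(EuclideanSpace ℝ (Fin n), ℂ)).comp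
          L.toLinearMap, (continuous_schwartz_seminorm 0 0).comp L.continuous,
        fun φ x => SchwartzMap.norm_le_seminorm ℂ (L φ) x⟩
    · exact ⟨(SchwartzMap.seminorm ℂ 0 0).comp ((partialCLM i ^ (m + 1)).comp L).toLinearMap,
        (continuous_schwartz_seminorm 0 0).comp ((partialCLM i ^ (m + 1)).comp L).continuous,
        fun φ x => norm_scaleMean_le i m _ x⟩
  differentiable := by
    rintro T (⟨L, rfl⟩ | ⟨m, L, -, rfl⟩) φ
    · exact (L φ).differentiable
    · exact fun x => (hasFDerivAt_scaleMean i m _ x).1.differentiableAt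
  coord_mul := by
    rintro T (⟨L, rfl⟩ | ⟨m, L, hL, rfl⟩) j
    · exact Submodule.subset_span (Or.inl ⟨(coordCLM j).comp L, by
        ext φ x; simp [coordCLM_apply]⟩)
    · by_cases hj : j = i
      · subst hj
        rcases m with _ | m
        · refine Submodule.subset_span (Or.inl ⟨L, ?_⟩)
          ext φ x
          rw [zero_add, pow_one, coord_mul_scaleMean_zero, hL φ (scaleCoord j 0 x) (by simp),
            sub_zero]
        · have h1 : (fun φ x => ((partialCLM j ^ (m + 1)).comp L) φ x) ∈
              Submodule.span ℂ (meanFamily V j) := Submodule.subset_span (Or.inl ⟨_, rfl⟩)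
          have h2 : (fun φ x => scaleMean j m ((partialCLM j ^ (m + 1)) (L φ)) x) ∈
              Submodule.span ℂ (meanFamily V j) := Submodule.subset_span (Or.inr ⟨m, L, hL, rfl⟩)
          convert Submodule.sub_mem _ h1 (Submodule.smul_mem _ ((m : ℂ) + 1) h2) using 1
          ext φ x
          simp only [pow_succ' _ (m + 1), mul_apply_eq_comp]
          exact coord_mul_scaleMean_succ j m _ x
      · refine Submodule.subset_span (Or.inr ⟨m, (coordCLM j).comp L, fun φ x hx => ?_, ?_⟩)
        · simp [coordCLM_apply, hL φ x hx]
        · ext φ x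
          rw [coord_mul_scaleMean_ne hj, ContinuousLinearMap.comp_apply,
            partialCLM_pow_coordCLM hj]
  partialDeriv := by
    rintro T (⟨L, rfl⟩ | ⟨m, L, hL, rfl⟩) j
    · exact Submodule.subset_span (Or.inl ⟨(partialCLM j).comp L, rfl⟩)
    · by_cases hj : j = i
      · subst hj
        refine Submodule.subset_span (Or.inr ⟨m + 1, L, hL, ?_⟩)
        ext φ x
        rw [pow_succ' _ (m + 1), mul_apply_eq_comp]
        exact fderiv_scaleMean_self j m _ x
      · refine Submodule.subset_span (Or.inr ⟨m, (partialCLM j).comp L, fun φ x hx => ?_, ?_⟩)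
        · rw [ContinuousLinearMap.comp_apply, partialCLM_apply_eq_lineDeriv, lineDeriv]
          have : ∀ t : ℝ, L φ (x + t • EuclideanSpace.single j 1) = 0 := fun t =>
            hL φ _ (by simp [hx, Ne.symm hj])
          simp [this]
        · ext φ x
          rw [ContinuousLinearMap.comp_apply, partialCLM_pow_comm]
          exact fderiv_scaleMean_ne hj m _ x

/-- If `L φ` vanishes for `xᵢ = 0`, then `L φ / xᵢ` is a Schwartz function that depends
continuously on `φ`. -/
theorem exists_clm_scaleMean {V : Type*} [AddCommGroup V] [Module ℂ V]
    [TopologicalSpace V] [IsTopologicalAddGroup V] (i : Fin n)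
    (L : V →L[ℂ] 𝓢(EuclideanSpace ℝ (Fin n), ℂ)) (hL : ∀ φ x, x i = 0 → L φ x = 0) :
    ∃ Q : V →L[ℂ] 𝓢(EuclideanSpace ℝ (Fin n), ℂ),
      ∀ φ x, Q φ x = scaleMean i 0 (partialCLM i (L φ)) x := by
  let T : V →ₗ[ℂ] EuclideanSpace ℝ (Fin n) → ℂ :=
    { toFun := fun φ => scaleMean i 0 (partialCLM i (L φ))
      map_add' := fun φ ψ => by rw [map_add, map_add, scaleMean_add]
      map_smul' := fun c φ => by rw [map_smul, map_smul, scaleMean_smul, RingHom.id_apply] }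
  exact (isSchwartzFamily_meanFamily V i).exists_clm T
    (Submodule.subset_span (Or.inr ⟨0, L, hL, by rw [zero_add, pow_one]; rfl⟩))

/-! ### Parity, and the Bessel operators on test functions. -/

/-- The two points have the same coordinates up to signs. -/
def SignRel (x y : EuclideanSpace ℝ (Fin n)) : Prop := ∀ i, x i = y i ∨ x i = -y i

theorem SignRel.add_smul_single {x y : EuclideanSpace ℝ (Fin n)} (h : SignRel x y) {i : Fin n}
    (hi : x i = y i) (t : ℝ) : SignRel (x + t • EuclideanSpace.single i 1)
      (y + t • EuclideanSpace.single i 1) := by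
  intro j
  by_cases hj : j = i
  · subst hj
    simp [hi]
  · simpa [hj] using h j

theorem SignRel.add_smul_single_neg {x y : EuclideanSpace ℝ (Fin n)} (h : SignRel x y) {i : Fin n}
    (hi : x i = -y i) (t : ℝ) : SignRel (x + t • EuclideanSpace.single i 1)
      (y + (-t) • EuclideanSpace.single i 1) := by
  intro j
  by_cases hj : j = i
  · subst hj
    right
    simp [hi]
    ring
  · simpa [hj] using h j

theorem SignRel.scaleCoord {x y : EuclideanSpace ℝ (Fin n)} (h : SignRel x y) (i : Fin n)
    (t : ℝ) : SignRel (scaleCoord i t x) (scaleCoord i t y) := by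
  intro j
  by_cases hj : j = i
  · subst hj
    rcases h j with h | h <;> simp [h]
  · simpa [scaleCoord_apply_ne hj] using h j

theorem lineDeriv_eq_of_forall {f : EuclideanSpace ℝ (Fin n) → ℂ}
    {x y e : EuclideanSpace ℝ (Fin n)} (h : ∀ t : ℝ, f (x + t • e) = f (y + t • e)) :
    lineDeriv ℝ f x e = lineDeriv ℝ f y e := by
  simp only [lineDeriv, h]

theorem lineDeriv_eq_neg_of_forall {f : EuclideanSpace ℝ (Fin n) → ℂ}
    {x y e : EuclideanSpace ℝ (Fin n)} {c : ℂ}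
    (h : ∀ t : ℝ, f (x + t • e) = c * f (y + (-t) • e)) :
    lineDeriv ℝ f x e = -(c * lineDeriv ℝ f y e) := by
  simp only [lineDeriv, h]
  rw [deriv_const_mul_field, deriv_comp_neg (fun t : ℝ => f (y + t • e)), neg_zero]
  ring

theorem EvenSchwartz.partialCLM_eq {φ : EvenSchwartz n} {x y : EuclideanSpace ℝ (Fin n)}
    (h : SignRel x y) {i : Fin n} (hi : x i = y i) :
    partialCLM i φ.1 x = partialCLM i φ.1 y := by
  simp only [partialCLM_apply_eq_lineDeriv]
  exact lineDeriv_eq_of_forall fun t => φ.2 _ _ (h.add_smul_single hi t)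

theorem EvenSchwartz.partialCLM_eq_neg {φ : EvenSchwartz n} {x y : EuclideanSpace ℝ (Fin n)}
    (h : SignRel x y) {i : Fin n} (hi : x i = -y i) :
    partialCLM i φ.1 x = -partialCLM i φ.1 y := by
  simp only [partialCLM_apply_eq_lineDeriv]
  rw [lineDeriv_eq_neg_of_forall (c := 1) (y := y), one_mul]
  intro t
  rw [one_mul]
  exact φ.2 _ _ (h.add_smul_single_neg hi t)

theorem EvenSchwartz.partialCLM_eq_zero (φ : EvenSchwartz n) {x : EuclideanSpace ℝ (Fin n)}
    {i : Fin n} (hi : x i = 0) : partialCLM i φ.1 x = 0 := by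
  have := EvenSchwartz.partialCLM_eq_neg (φ := φ) (x := x) (y := x) (i := i)
    (fun j => Or.inl rfl) (by simp [hi])
  exact self_eq_neg.mp this

theorem EvenSchwartz.partialCLM_partialCLM_mem (i : Fin n) (φ : EvenSchwartz n) :
    partialCLM i (partialCLM i φ.1) ∈ EvenSchwartz n := by
  intro x y h
  rw [partialCLM_apply_eq_lineDeriv, partialCLM_apply_eq_lineDeriv]
  rcases h i with hi | hi
  · refine lineDeriv_eq_of_forall fun t =>
      EvenSchwartz.partialCLM_eq (SignRel.add_smul_single h hi t) ?_
    simp [hi]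
  · rw [lineDeriv_eq_neg_of_forall (c := -1) (y := y)]
    · simp
    · intro t
      rw [neg_one_mul]
      refine EvenSchwartz.partialCLM_eq_neg (SignRel.add_smul_single_neg h hi t) ?_
      simp [hi]
      ring

/-- `∂ᵢ φ` is odd in `xᵢ`, hence vanishes on `xᵢ = 0` and can be divided by `xᵢ`. The quotient is a
mean of the function `∂ᵢ² φ`, which is even, and so inherits evenness. -/
theorem exists_divDeriv (i : Fin n) : ∃ D : EvenSchwartz n →L[ℂ] EvenSchwartz n,
    ∀ φ x, (x i : ℂ) * (D φ).1 x = partialCLM i φ.1 x := by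
  obtain ⟨Q, hQ⟩ := exists_clm_scaleMean i ((partialCLM i).comp (EvenSchwartz n).subtypeL)
    fun φ x hx => EvenSchwartz.partialCLM_eq_zero φ hx
  have hmem : ∀ φ, Q φ ∈ EvenSchwartz n := by
    intro φ x y h
    rw [hQ, hQ]
    refine intervalIntegral.integral_congr fun t _ => ?_
    exact congrArg _ (EvenSchwartz.partialCLM_partialCLM_mem i φ _ _ (SignRel.scaleCoord h i t))
  refine ⟨Q.codRestrict (EvenSchwartz n) hmem, fun φ x => ?_⟩
  rw [ContinuousLinearMap.coe_codRestrict_apply, hQ, coord_mul_scaleMean_zero]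
  simp only [ContinuousLinearMap.comp_apply, Submodule.subtypeL_apply]
  rw [EvenSchwartz.partialCLM_eq_zero φ (x := scaleCoord i 0 x) (by simp), sub_zero]

/-- The operator `(1 / xᵢ) ∂ / ∂xᵢ` on the test functions. -/
def divDeriv (i : Fin n) : EvenSchwartz n →L[ℂ] EvenSchwartz n := (exists_divDeriv i).choose

theorem coord_mul_divDeriv (i : Fin n) (φ : EvenSchwartz n) (x : EuclideanSpace ℝ (Fin n)) :
    (x i : ℂ) * (divDeriv i φ).1 x = partialCLM i φ.1 x :=
  (exists_divDeriv i).choose_spec φ x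

/-- The second partial derivative on the test functions. -/
def partialSq (i : Fin n) : EvenSchwartz n →L[ℂ] EvenSchwartz n :=
  ((partialCLM i).comp ((partialCLM i).comp (EvenSchwartz n).subtypeL)).codRestrict (EvenSchwartz n)
    (EvenSchwartz.partialCLM_partialCLM_mem i)

/-- The Bessel operator on the test functions. -/
def besselTest (v : Fin n → ℝ) (i : Fin n) : EvenSchwartz n →L[ℂ] EvenSchwartz n :=
  partialSq i + (2 * v i : ℂ) • divDeriv i

theorem besselTest_apply (v : Fin n → ℝ) (i : Fin n) (φ : EvenSchwartz n)
    (x : EuclideanSpace ℝ (Fin n)) : (besselTest v i φ).1 x =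
      partialCLM i (partialCLM i φ.1) x + 2 * v i * (divDeriv i φ).1 x := rfl

theorem realizes_besselTest (v : Fin n → ℝ) (i : Fin n) :
    Realizes (besselDeriv v i) (besselTest v i) := by
  intro φ x hx
  have hx' : (x i : ℂ) ≠ 0 := by exact_mod_cast (hx i).ne'
  rw [besselTest_apply, besselDeriv, ← partialCLM_apply_eq_lineDeriv, ← coord_mul_divDeriv]
  congr 1
  · rw [partialCLM_apply_eq_lineDeriv]
    congr 1
    exact funext fun y => partialCLM_apply_eq_lineDeriv i φ.1 y
  · push_cast
    field_simp

theorem Realizes.onTest_eq {A : (EuclideanSpace ℝ (Fin n) → ℂ) → EuclideanSpace ℝ (Fin n) → ℂ}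
    {L : EvenSchwartz n →L[ℂ] EvenSchwartz n} (h : Realizes A L) : onTest A = L := by
  have hex : ∃ L, Realizes A L := ⟨L, h⟩
  rw [onTest, dif_pos hex]
  ext1 φ
  exact EvenSchwartz.ext_orthant fun x hx => by rw [hex.choose_spec φ x hx, h φ x hx]

/-! ### The weighted measure. -/

theorem measurableSet_orthant (n : ℕ) : MeasurableSet (orthant n) := by
  have : orthant n = ⋂ i, {x | 0 < x i} := by ext; simp [orthant]
  rw [this]
  exact MeasurableSet.iInter fun i => (isOpen_lt continuous_const (by fun_prop)).measurableSet

/-- The weight, extended by zero outside the orthant. -/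
def posWeight (v : Fin n → ℝ) (x : EuclideanSpace ℝ (Fin n)) : ℝ := ∏ i, max (x i) 0 ^ (2 * v i)

theorem posWeight_nonneg (v : Fin n → ℝ) (x : EuclideanSpace ℝ (Fin n)) : 0 ≤ posWeight v x :=
  Finset.prod_nonneg fun _ _ => rpow_nonneg (le_max_right _ _) _

theorem measurable_posWeight (v : Fin n → ℝ) : Measurable (posWeight v) := by
  unfold posWeight
  fun_prop

/-- Positive exponents make the extended weight vanish as soon as one coordinate is nonpositive;
integrals over the orthant thus become integrals over the whole space. -/
theorem indicator_weight {v : Fin n → ℝ} (hv : ∀ i, 0 < v i) :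
    (orthant n).indicator (weight v) = posWeight v := by
  ext x
  by_cases hx : x ∈ orthant n
  · rw [indicator_of_mem hx]
    exact Finset.prod_congr rfl fun i _ => by rw [max_eq_left (hx i).le]
  · rw [indicator_of_notMem hx]
    obtain ⟨i, hi⟩ : ∃ i, x i ≤ 0 := by simpa [orthant] using hx
    refine (Finset.prod_eq_zero (Finset.mem_univ i) ?_).symm
    rw [max_eq_right hi, zero_rpow (by have := hv i; positivity)]

/-- The measure with density `∏ xᵢ ^ (2 vᵢ)` on the orthant. -/
def besselMeasure (v : Fin n → ℝ) : Measure (EuclideanSpace ℝ (Fin n)) :=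
  volume.withDensity fun x => ((posWeight v x).toNNReal : ENNReal)

theorem integral_besselMeasure (v : Fin n → ℝ) (f : EuclideanSpace ℝ (Fin n) → ℂ) :
    ∫ x, f x ∂besselMeasure v = ∫ x, (posWeight v x : ℂ) * f x := by
  rw [besselMeasure, integral_withDensity_eq_integral_smul (measurable_posWeight v).real_toNNReal]
  simp [NNReal.smul_def, posWeight_nonneg]

theorem integrable_besselMeasure_iff (v : Fin n → ℝ) {f : EuclideanSpace ℝ (Fin n) → ℂ} :
    Integrable f (besselMeasure v) ↔ Integrable fun x => (posWeight v x : ℂ) * f x := by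
  rw [besselMeasure,
    integrable_withDensity_iff_integrable_smul (measurable_posWeight v).real_toNNReal]
  simp [NNReal.smul_def, posWeight_nonneg]

theorem indicator_weight_mul {v : Fin n → ℝ} (hv : ∀ i, 0 < v i)
    (f : EuclideanSpace ℝ (Fin n) → ℂ) :
    (orthant n).indicator (fun x => (weight v x : ℂ) * f x) =
      fun x => (posWeight v x : ℂ) * f x := by
  ext x
  rw [← indicator_weight hv]
  by_cases hx : x ∈ orthant n <;> simp [hx]

theorem setIntegral_orthant_weight {v : Fin n → ℝ} (hv : ∀ i, 0 < v i)
    (f : EuclideanSpace ℝ (Fin n) → ℂ) :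
    ∫ x in orthant n, (weight v x : ℂ) * f x = ∫ x, f x ∂besselMeasure v := by
  rw [← integral_indicator (measurableSet_orthant n), indicator_weight_mul hv,
    integral_besselMeasure]

theorem integrableOn_orthant_weight {v : Fin n → ℝ} (hv : ∀ i, 0 < v i)
    {f : EuclideanSpace ℝ (Fin n) → ℂ} :
    IntegrableOn (fun x => (weight v x : ℂ) * f x) (orthant n) ↔
      Integrable f (besselMeasure v) := by
  rw [← integrable_indicator_iff (measurableSet_orthant n), indicator_weight_mul hv,
    integrable_besselMeasure_iff]

theorem posWeight_le {v : Fin n → ℝ} (hv : ∀ i, 0 < v i) (x : EuclideanSpace ℝ (Fin n)) :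
    posWeight v x ≤ (1 + ‖x‖) ^ ∑ i, 2 * v i := by
  have hx := norm_nonneg x
  rw [rpow_sum_of_pos (by positivity)]
  refine Finset.prod_le_prod (fun i _ => rpow_nonneg (le_max_right _ _) _) fun i _ => ?_
  refine rpow_le_rpow (le_max_right _ _) (max_le ?_ (by positivity)) (by have := hv i; positivity)
  have := PiLp.norm_apply_le x i
  rw [norm_eq_abs] at this
  linarith [le_abs_self (x i)]

/-- The density grows at most like `(1 + ‖x‖) ^ ∑ 2vᵢ`, so any `N > n + ∑ 2vᵢ` makes `(1 +
‖x‖)^(-N)` integrable. Schwartz functions are then integrable for this measure. -/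
theorem hasTemperateGrowth_besselMeasure {v : Fin n → ℝ} (hv : ∀ i, 0 < v i) :
    (besselMeasure v).HasTemperateGrowth := by
  obtain ⟨N, hN⟩ := exists_nat_gt ((n : ℝ) + ∑ i, 2 * v i)
  refine ⟨N, ?_⟩
  rw [besselMeasure,
    integrable_withDensity_iff_integrable_smul (measurable_posWeight v).real_toNNReal]
  have h := integrable_one_add_norm (E := EuclideanSpace ℝ (Fin n)) (μ := volume)
    (r := N - ∑ i, 2 * v i) (by rw [finrank_euclideanSpace_fin]; linarith)
  refine h.mono' ?_ (Eventually.of_forall fun x => ?_)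
  · refine ((measurable_posWeight v).real_toNNReal.smul ?_).aestronglyMeasurable
    fun_prop
  · have hx : 0 < 1 + ‖x‖ := by positivity
    rw [NNReal.smul_def, coe_toNNReal _ (posWeight_nonneg v x), smul_eq_mul, norm_mul,
      norm_of_nonneg (posWeight_nonneg v x), norm_of_nonneg (by positivity),
      show -((N : ℝ) - ∑ i, 2 * v i) = (∑ i, 2 * v i) + -(N : ℝ) by ring, rpow_add hx]
    gcongr
    exact posWeight_le hv x

/-! ### The kernel and the Fourier–Bessel integral. -/

/-- The kernel `∏ j_{vᵢ - 1/2}(xᵢ yᵢ)` of the Fourier–Bessel transform. -/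
def fbKernel (v : Fin n → ℝ) (x y : EuclideanSpace ℝ (Fin n)) : ℝ :=
  ∏ i, normalizedBessel (v i - 1 / 2) (x i * y i)

theorem fbKernel_comm (v : Fin n → ℝ) (x y : EuclideanSpace ℝ (Fin n)) :
    fbKernel v x y = fbKernel v y x := by
  simp only [fbKernel, mul_comm (x _)]

theorem fbKernel_zero_left {v : Fin n → ℝ} (hv : ∀ i, 0 < v i) (y : EuclideanSpace ℝ (Fin n)) :
    fbKernel v 0 y = 1 :=
  Finset.prod_eq_one fun i _ => by simpa using normalizedBessel_zero (hv i)

theorem fbKernel_eq_of_signRel (v : Fin n → ℝ) {x x' : EuclideanSpace ℝ (Fin n)}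
    (h : SignRel x x') (y : EuclideanSpace ℝ (Fin n)) : fbKernel v x y = fbKernel v x' y := by
  refine Finset.prod_congr rfl fun i _ => ?_
  rcases h i with h | h <;> rw [h]
  rw [neg_mul, normalizedBessel_neg]

theorem abs_fbKernel_le_one {v : Fin n → ℝ} (hv : ∀ i, 0 < v i)
    (x y : EuclideanSpace ℝ (Fin n)) : |fbKernel v x y| ≤ 1 := by
  rw [fbKernel, Finset.abs_prod]
  exact Finset.prod_le_one (fun _ _ => abs_nonneg _) fun i _ =>
    abs_normalizedBessel_le_one (hv i) _

theorem continuous_fbKernel {v : Fin n → ℝ} (hv : ∀ i, 0 < v i) :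
    Continuous fun p : EuclideanSpace ℝ (Fin n) × EuclideanSpace ℝ (Fin n) =>
      fbKernel v p.1 p.2 :=
  continuous_finsetProd _ fun i _ => (continuous_normalizedBessel (hv i)).comp (by fun_prop)

theorem continuous_fbKernel_right {v : Fin n → ℝ} (hv : ∀ i, 0 < v i)
    (x : EuclideanSpace ℝ (Fin n)) : Continuous (fbKernel v x) :=
  continuous_finsetProd _ fun i _ => (continuous_normalizedBessel (hv i)).comp (by fun_prop)

theorem fbIntegral_eq {v : Fin n → ℝ} (hv : ∀ i, 0 < v i) (f : EuclideanSpace ℝ (Fin n) → ℂ)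
    (x : EuclideanSpace ℝ (Fin n)) :
    fbIntegral v f x = fbConst v * ∫ y, f y * (fbKernel v x y : ℂ) ∂besselMeasure v := by
  rw [fbIntegral, ← setIntegral_orthant_weight hv]
  congr 2 with y
  rw [Finset.prod_mul_distrib, fbKernel, weight]
  push_cast
  ring

theorem integrable_mul_fbKernel {v w : Fin n → ℝ} (hv : ∀ i, 0 < v i)
    {f : EuclideanSpace ℝ (Fin n) → ℂ} (hf : Integrable f (besselMeasure w))
    (x : EuclideanSpace ℝ (Fin n)) :
    Integrable (fun y => f y * (fbKernel v x y : ℂ)) (besselMeasure w) := by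
  refine hf.mul_bdd (c := 1)
    (Complex.continuous_ofReal.comp (continuous_fbKernel_right hv x)).aestronglyMeasurable
    (Eventually.of_forall fun y => ?_)
  rw [Complex.norm_real]
  exact abs_fbKernel_le_one hv x y

theorem integrable_schwartz {v : Fin n → ℝ} (hv : ∀ i, 0 < v i)
    (f : 𝓢(EuclideanSpace ℝ (Fin n), ℂ)) : Integrable f (besselMeasure v) :=
  have := hasTemperateGrowth_besselMeasure hv
  f.integrable

theorem fbConst_pos {v : Fin n → ℝ} (hv : ∀ i, 0 < v i) : 0 < fbConst v := by
  refine inv_pos.mpr (Finset.prod_pos fun i _ => ?_)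
  have := hv i
  have : 0 < Gamma (v i + 1 / 2) := Gamma_pos_of_pos (by positivity)
  positivity

/-- A Fourier–Bessel integral is bounded by a continuous seminorm. -/
theorem exists_seminorm_fbIntegral_le {v : Fin n → ℝ} (hv : ∀ i, 0 < v i) :
    ∃ p : Seminorm ℂ 𝓢(EuclideanSpace ℝ (Fin n), ℂ), Continuous p ∧
      ∀ (f : 𝓢(EuclideanSpace ℝ (Fin n), ℂ)) x, ‖fbIntegral v f x‖ ≤ p f := by
  have := hasTemperateGrowth_besselMeasure hv
  let A : 𝓢(EuclideanSpace ℝ (Fin n), ℂ) →L[ℂ] Lp ℂ 1 (besselMeasure v) :=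
    (fbConst v : ℂ) • SchwartzMap.toLpCLM ℂ ℂ 1 (besselMeasure v)
  refine ⟨(normSeminorm ℂ _).comp A.toLinearMap, continuous_norm.comp A.continuous, fun f x => ?_⟩
  have h1 : (normSeminorm ℂ (Lp ℂ 1 (besselMeasure v))).comp A.toLinearMap f =
      ‖(fbConst v : ℂ)‖ * ∫ y, ‖f y‖ ∂besselMeasure v := by
    rw [← SchwartzMap.norm_toLp_one, ← norm_smul]
    rfl
  rw [h1, fbIntegral_eq hv, norm_mul]
  refine mul_le_mul_of_nonneg_left ?_ (norm_nonneg _)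
  refine norm_integral_le_of_norm_le (integrable_schwartz hv f).norm
    (Eventually.of_forall fun y => ?_)
  rw [norm_mul, Complex.norm_real]
  exact mul_le_of_le_one_right (norm_nonneg _) (abs_fbKernel_le_one hv x y)

theorem fbIntegral_add {v : Fin n → ℝ} (hv : ∀ i, 0 < v i)
    (f g : 𝓢(EuclideanSpace ℝ (Fin n), ℂ)) (x : EuclideanSpace ℝ (Fin n)) :
    fbIntegral v (f + g : 𝓢(EuclideanSpace ℝ (Fin n), ℂ)) x =
      fbIntegral v f x + fbIntegral v g x := by
  simp only [fbIntegral_eq hv]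
  rw [← mul_add, ← integral_add (integrable_mul_fbKernel hv (integrable_schwartz hv f) x)
    (integrable_mul_fbKernel hv (integrable_schwartz hv g) x)]
  simp [add_mul]

theorem fbIntegral_smul {v : Fin n → ℝ} (hv : ∀ i, 0 < v i) (c : ℂ)
    (f : 𝓢(EuclideanSpace ℝ (Fin n), ℂ)) (x : EuclideanSpace ℝ (Fin n)) :
    fbIntegral v (c • f : 𝓢(EuclideanSpace ℝ (Fin n), ℂ)) x = c * fbIntegral v f x := by
  simp only [fbIntegral_eq hv]
  have h : ∀ y, (c • f) y * (fbKernel v x y : ℂ) = c * (f y * (fbKernel v x y : ℂ)) := fun y => by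
    rw [_root_.smul_apply, smul_eq_mul, mul_assoc]
  simp only [h]
  rw [integral_const_mul, mul_left_comm]

/-- The Fourier–Bessel integral as a linear map on Schwartz functions. -/
def fbLinear {v : Fin n → ℝ} (hv : ∀ i, 0 < v i) :
    𝓢(EuclideanSpace ℝ (Fin n), ℂ) →ₗ[ℂ] EuclideanSpace ℝ (Fin n) → ℂ where
  toFun f := fbIntegral v f
  map_add' f g := funext (fbIntegral_add hv f g)
  map_smul' c f := funext (fbIntegral_smul hv c f)

/-! ### Raising an exponent, and derivatives of the transform. -/

/-- The exponents `v` with `vᵢ` raised by one. -/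
def bump (v : Fin n → ℝ) (i : Fin n) : Fin n → ℝ := Function.update v i (v i + 1)

theorem bump_pos {v : Fin n → ℝ} (hv : ∀ i, 0 < v i) (i : Fin n) : ∀ j, 0 < bump v i j := by
  intro j
  by_cases h : j = i
  · subst h
    have := hv j
    simp only [bump, Function.update_self]
    positivity
  · simpa [bump, h] using hv j

@[simp] theorem bump_self (v : Fin n → ℝ) (i : Fin n) : bump v i i = v i + 1 := by simp [bump]

theorem bump_of_ne (v : Fin n → ℝ) {i j : Fin n} (h : j ≠ i) : bump v i j = v j := by
  simp [bump, h]

theorem posWeight_bump {v : Fin n → ℝ} (hv : ∀ i, 0 < v i) (i : Fin n)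
    (x : EuclideanSpace ℝ (Fin n)) : posWeight (bump v i) x = posWeight v x * x i ^ 2 := by
  rw [posWeight, posWeight, ← Finset.mul_prod_erase _ _ (Finset.mem_univ i),
    ← Finset.mul_prod_erase _ (fun j => max (x j) 0 ^ (2 * v j)) (Finset.mem_univ i)]
  have h1 : ∏ j ∈ Finset.univ.erase i, max (x j) 0 ^ (2 * bump v i j) =
      ∏ j ∈ Finset.univ.erase i, max (x j) 0 ^ (2 * v j) :=
    Finset.prod_congr rfl fun j hj => by rw [bump_of_ne v (Finset.ne_of_mem_erase hj)]
  have h2 : max (x i) 0 ^ (2 * (v i + 1)) = max (x i) 0 ^ (2 * v i) * x i ^ 2 := by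
    have := hv i
    rcases le_or_gt (x i) 0 with h | h
    · rw [max_eq_right h, zero_rpow (by positivity), zero_rpow (by positivity), zero_mul]
    · rw [max_eq_left h.le, mul_add, mul_one, rpow_add h, rpow_two]
  rw [h1, bump_self, h2]
  ring

theorem integral_besselMeasure_bump {v : Fin n → ℝ} (hv : ∀ i, 0 < v i) (i : Fin n)
    (f : EuclideanSpace ℝ (Fin n) → ℂ) :
    ∫ x, f x ∂besselMeasure (bump v i) = ∫ x, (x i : ℂ) ^ 2 * f x ∂besselMeasure v := by
  rw [integral_besselMeasure, integral_besselMeasure]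
  congr 1 with x
  rw [posWeight_bump hv]
  push_cast
  ring

theorem fbConst_bump {v : Fin n → ℝ} (hv : ∀ i, 0 < v i) (i : Fin n) :
    (2 * v i + 1) * fbConst (bump v i) = fbConst v := by
  have hvi := hv i
  have hi : 0 < v i + 1 / 2 := by positivity
  rw [fbConst, fbConst, ← Finset.mul_prod_erase _ _ (Finset.mem_univ i),
    ← Finset.mul_prod_erase _ (fun j => (2 : ℝ) ^ (v j - 1 / 2) * Gamma (v j + 1 / 2))
      (Finset.mem_univ i)]
  have h1 : ∏ j ∈ Finset.univ.erase i,
        (2 : ℝ) ^ (bump v i j - 1 / 2) * Gamma (bump v i j + 1 / 2) =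
      ∏ j ∈ Finset.univ.erase i, (2 : ℝ) ^ (v j - 1 / 2) * Gamma (v j + 1 / 2) :=
    Finset.prod_congr rfl fun j hj => by rw [bump_of_ne v (Finset.ne_of_mem_erase hj)]
  have h2 : (2 : ℝ) ^ (v i + 1 - 1 / 2) * Gamma (v i + 1 + 1 / 2) =
      (2 * v i + 1) * ((2 : ℝ) ^ (v i - 1 / 2) * Gamma (v i + 1 / 2)) := by
    rw [show v i + 1 - 1 / 2 = (v i - 1 / 2) + 1 by ring, rpow_add two_pos, rpow_one,
      show v i + 1 + 1 / 2 = (v i + 1 / 2) + 1 by ring, Gamma_add_one hi.ne']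
    ring
  rw [h1, bump_self, h2, mul_assoc, mul_inv (2 * v i + 1), ← mul_assoc,
    mul_inv_cancel₀ (by positivity), one_mul]

/-- The kernel without the factor of the `i`-th variable. -/
def fbKernelErase (v : Fin n → ℝ) (i : Fin n) (x y : EuclideanSpace ℝ (Fin n)) : ℝ :=
  ∏ j ∈ Finset.univ.erase i, normalizedBessel (v j - 1 / 2) (x j * y j)

theorem fbKernel_eq_erase (v : Fin n → ℝ) (i : Fin n) (x y : EuclideanSpace ℝ (Fin n)) :
    fbKernel v x y = fbKernelErase v i x y * normalizedBessel (v i - 1 / 2) (x i * y i) :=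
  (Finset.prod_erase_mul _ _ (Finset.mem_univ i)).symm

theorem fbKernelErase_bump (v : Fin n → ℝ) (i : Fin n) (x y : EuclideanSpace ℝ (Fin n)) :
    fbKernelErase (bump v i) i x y = fbKernelErase v i x y :=
  Finset.prod_congr rfl fun j hj => by rw [bump_of_ne v (Finset.ne_of_mem_erase hj)]

theorem fbKernel_bump (v : Fin n → ℝ) (i : Fin n) (x y : EuclideanSpace ℝ (Fin n)) :
    fbKernel (bump v i) x y =
      fbKernelErase v i x y * normalizedBessel (v i + 1 - 1 / 2) (x i * y i) := by
  rw [fbKernel_eq_erase _ i, fbKernelErase_bump, bump_self]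

theorem fbKernel_recurrence {v : Fin n → ℝ} (hv : ∀ i, 0 < v i) (i : Fin n)
    (x y : EuclideanSpace ℝ (Fin n)) :
    fbKernel v x y = fbKernel (bump v i) x y -
      (x i * y i) ^ 2 / ((2 * v i + 1) * (2 * v i + 3)) * fbKernel (bump (bump v i) i) x y := by
  rw [fbKernel_bump, fbKernel_bump, fbKernelErase_bump, bump_self, fbKernel_eq_erase v i,
    normalizedBessel_recurrence (hv i), show v i + 1 + 1 = v i + 2 by ring]
  ring

/-- The derivative of the kernel in the first variable. -/
def fbKernelDeriv (v : Fin n → ℝ) (x y : EuclideanSpace ℝ (Fin n)) :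
    EuclideanSpace ℝ (Fin n) →L[ℝ] ℝ :=
  ∑ i, (-(x i * y i ^ 2 / (2 * v i + 1)) * fbKernel (bump v i) x y) •
    (EuclideanSpace.proj i : EuclideanSpace ℝ (Fin n) →L[ℝ] ℝ)

theorem hasFDerivAt_fbKernel {v : Fin n → ℝ} (hv : ∀ i, 0 < v i)
    (x y : EuclideanSpace ℝ (Fin n)) :
    HasFDerivAt (fun x => fbKernel v x y) (fbKernelDeriv v x y) x := by
  have h : ∀ i ∈ Finset.univ, HasFDerivAt
      (fun x : EuclideanSpace ℝ (Fin n) => normalizedBessel (v i - 1 / 2) (x i * y i))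
      ((-(x i * y i / (2 * v i + 1)) * normalizedBessel (v i + 1 - 1 / 2) (x i * y i)) •
        y i • (EuclideanSpace.proj i : EuclideanSpace ℝ (Fin n) →L[ℝ] ℝ)) x := by
    intro i _
    have h1 : HasFDerivAt (fun x : EuclideanSpace ℝ (Fin n) => x i * y i)
        (y i • (EuclideanSpace.proj i : EuclideanSpace ℝ (Fin n) →L[ℝ] ℝ)) x :=
      (EuclideanSpace.proj i : EuclideanSpace ℝ (Fin n) →L[ℝ] ℝ).hasFDerivAt.mul_const (y i)
    have h2 := (hasDerivAt_normalizedBessel (hv i) (x i * y i)).comp_hasFDerivAt x h1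
    exact h2
  refine (HasFDerivAt.finsetProd h).congr_fderiv ?_
  refine Finset.sum_congr rfl fun i _ => ?_
  rw [smul_smul, smul_smul, fbKernel_bump, fbKernelErase]
  congr 1
  ring

theorem fbKernelDeriv_single (v : Fin n → ℝ) (i : Fin n) (x y : EuclideanSpace ℝ (Fin n)) :
    fbKernelDeriv v x y (EuclideanSpace.single i 1) =
      -(x i * y i ^ 2 / (2 * v i + 1)) * fbKernel (bump v i) x y := by
  simp [fbKernelDeriv, PiLp.single_apply]

theorem norm_fbKernelDeriv_le {v : Fin n → ℝ} (hv : ∀ i, 0 < v i)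
    (x y : EuclideanSpace ℝ (Fin n)) : ‖fbKernelDeriv v x y‖ ≤ n * (‖x‖ * ‖y‖ ^ 2) := by
  refine (norm_sum_le _ _).trans ?_
  have : ∀ i ∈ Finset.univ, ‖(-(x i * y i ^ 2 / (2 * v i + 1)) * fbKernel (bump v i) x y) •
      (EuclideanSpace.proj i : EuclideanSpace ℝ (Fin n) →L[ℝ] ℝ)‖ ≤ ‖x‖ * ‖y‖ ^ 2 := by
    intro i _
    have hvi := hv i
    have hp : ‖(EuclideanSpace.proj i : EuclideanSpace ℝ (Fin n) →L[ℝ] ℝ)‖ ≤ 1 :=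
      ContinuousLinearMap.opNorm_le_bound _ zero_le_one fun z => by
        simpa using PiLp.norm_apply_le z i
    have hx : |x i| ≤ ‖x‖ := PiLp.norm_apply_le x i
    have hy : |y i| ≤ ‖y‖ := PiLp.norm_apply_le y i
    rw [norm_smul, norm_mul, norm_neg, norm_div, norm_mul, norm_pow]
    simp only [norm_eq_abs]
    rw [abs_of_pos (by positivity : 0 < 2 * v i + 1)]
    calc |x i| * |y i| ^ 2 / (2 * v i + 1) * |fbKernel (bump v i) x y| * _
        ≤ |x i| * |y i| ^ 2 / (2 * v i + 1) * 1 * 1 := by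
          gcongr
          exact abs_fbKernel_le_one (bump_pos hv i) x y
      _ ≤ |x i| * |y i| ^ 2 := by
          rw [mul_one, mul_one]
          exact div_le_self (by positivity) (by linarith)
      _ ≤ _ := by gcongr
  refine (Finset.sum_le_sum this).trans ?_
  simp

/-- Differentiating the kernel produces `-xᵢ yᵢ² / (2vᵢ + 1)` times the kernel with raised exponent.
The factor `yᵢ²` turns the measure into that of the raised exponent, and `2vᵢ + 1` is absorbed by
the constant. -/
theorem fderiv_fbIntegral {v : Fin n → ℝ} (hv : ∀ i, 0 < v i)
    (f : 𝓢(EuclideanSpace ℝ (Fin n), ℂ)) (x : EuclideanSpace ℝ (Fin n)) :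
    DifferentiableAt ℝ (fbIntegral v f) x ∧ ∀ i,
      fderiv ℝ (fbIntegral v f) x (EuclideanSpace.single i 1) =
        -(x i * fbIntegral (bump v i) f x) := by
  have := hasTemperateGrowth_besselMeasure hv
  let F' : EuclideanSpace ℝ (Fin n) → EuclideanSpace ℝ (Fin n) →
      EuclideanSpace ℝ (Fin n) →L[ℝ] ℂ :=
    fun x y => f y • Complex.ofRealCLM.comp (fbKernelDeriv v x y)
  have hcont : Continuous (F' x) := by
    refine f.continuous.smul (continuous_const.clm_comp ?_)
    refine continuous_finsetSum _ fun i _ => Continuous.fun_smul ?_ continuous_const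
    exact Continuous.mul (by fun_prop) (continuous_fbKernel_right (bump_pos hv i) x)
  have hb : Integrable (fun y => n * (‖x‖ + 1) * (‖y‖ ^ 2 * ‖f y‖)) (besselMeasure v) :=
    (f.integrable_pow_mul (besselMeasure v) 2).const_mul _
  -- The derivative of the kernel grows with `x`, so the domination is uniform only on a ball around
  -- the given point.
  have hbound : ∀ y, ∀ x' ∈ Metric.ball x 1, ‖F' x' y‖ ≤ n * (‖x‖ + 1) * (‖y‖ ^ 2 * ‖f y‖) := by
    intro y x' hx'
    have h1 : ‖x'‖ ≤ ‖x‖ + 1 := by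
      have := norm_sub_norm_le x' x
      rw [Metric.mem_ball, dist_eq_norm] at hx'
      linarith
    rw [norm_smul]
    calc ‖f y‖ * ‖Complex.ofRealCLM.comp (fbKernelDeriv v x' y)‖
        ≤ ‖f y‖ * (1 * (n * (‖x'‖ * ‖y‖ ^ 2))) := by
          gcongr
          refine (ContinuousLinearMap.opNorm_comp_le _ _).trans ?_
          rw [Complex.ofRealCLM_norm]
          gcongr
          exact norm_fbKernelDeriv_le hv x' y
      _ ≤ ‖f y‖ * (1 * (n * ((‖x‖ + 1) * ‖y‖ ^ 2))) := by gcongr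
      _ = _ := by ring
  have hd := hasFDerivAt_integral_of_dominated_of_fderiv_le (μ := besselMeasure v) (x₀ := x)
    (F := fun x y => f y * (fbKernel v x y : ℂ)) (F' := F')
    (Metric.ball_mem_nhds x one_pos)
    (Eventually.of_forall fun x =>
      (integrable_mul_fbKernel hv (integrable_schwartz hv f) x).aestronglyMeasurable)
    (integrable_mul_fbKernel hv (integrable_schwartz hv f) x)
    hcont.aestronglyMeasurable (Eventually.of_forall hbound) hb
    (Eventually.of_forall fun y x' _ =>
      ((Complex.ofRealCLM.hasFDerivAt.comp x' (hasFDerivAt_fbKernel hv x' y)).const_mul (f y)))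
  have hF'int : Integrable (F' x) (besselMeasure v) :=
    hb.mono' hcont.aestronglyMeasurable
      (Eventually.of_forall fun y => hbound y x (Metric.mem_ball_self one_pos))
  have hfun : fbIntegral v f =
      fun x => (fbConst v : ℂ) * ∫ y, f y * (fbKernel v x y : ℂ) ∂besselMeasure v :=
    funext (fbIntegral_eq hv f)
  have hd' := hd.const_mul (fbConst v : ℂ)
  rw [← hfun] at hd'
  refine ⟨hd'.differentiableAt, fun i => ?_⟩
  rw [hd'.fderiv, fbIntegral_eq (bump_pos hv i), integral_besselMeasure_bump hv,
    _root_.smul_apply, ContinuousLinearMap.integral_apply hF'int, smul_eq_mul]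
  have h1 : ∀ y, F' x y (EuclideanSpace.single i 1) =
      (-(x i / (2 * v i + 1)) : ℂ) * ((y i : ℂ) ^ 2 * (f y * (fbKernel (bump v i) x y : ℂ))) := by
    intro y
    simp only [F', _root_.smul_apply, ContinuousLinearMap.comp_apply, fbKernelDeriv_single,
      smul_eq_mul, Complex.ofRealCLM_apply]
    push_cast
    ring
  simp only [h1]
  have hvi := hv i
  have h2 : (2 * v i + 1 : ℂ) ≠ 0 := by
    have : (2 * v i + 1 : ℝ) ≠ 0 := by positivity
    exact_mod_cast this
  rw [integral_const_mul, ← fbConst_bump hv i]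
  push_cast
  field_simp

/-! ### Integration by parts: the transform of a Bessel operator. -/

theorem hasDerivAt_max_zero_rpow {r : ℝ} (hr : 1 < r) (s : ℝ) :
    HasDerivAt (fun s => max s 0 ^ r) (r * max s 0 ^ (r - 1)) s := by
  have hr0 : r ≠ 0 := by positivity
  have hr1 : r - 1 ≠ 0 := by linarith
  have hright : HasDerivWithinAt (fun s => max s 0 ^ r) (r * max s 0 ^ (r - 1)) (Ici 0) s := by
    by_cases hs : 0 ≤ s
    · have h := (hasDerivAt_rpow_const (x := s) (Or.inr hr.le)).hasDerivWithinAt (s := Ici 0)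
      rw [max_eq_left hs]
      exact h.congr (fun y hy => by rw [max_eq_left hy]) (by rw [max_eq_left hs])
    · exact HasFDerivWithinAt.of_notMem_closure (by simpa [closure_Ici] using hs)
  have hleft : HasDerivWithinAt (fun s => max s 0 ^ r) (r * max s 0 ^ (r - 1)) (Iic 0) s := by
    by_cases hs : s ≤ 0
    · rw [max_eq_right hs, zero_rpow hr1, mul_zero]
      refine (hasDerivWithinAt_const s (Iic 0) (0 : ℝ)).congr (fun y hy => ?_) ?_
      · rw [max_eq_right hy, zero_rpow hr0]
      · rw [max_eq_right hs, zero_rpow hr0]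
    · exact HasFDerivWithinAt.of_notMem_closure (by simpa [closure_Iic] using hs)
  have h := hleft.union hright
  rwa [Iic_union_Ici, hasDerivWithinAt_univ] at h

/-- The extra factor `yᵢ` raises the exponent to `2vᵢ + 1 > 1`, so the product is differentiable
across `yᵢ = 0` even when the weight alone is not. Integration by parts then runs over the whole
space without boundary terms. -/
theorem hasLineDerivAt_coord_mul_posWeight {v : Fin n → ℝ} (hv : ∀ i, 0 < v i) (i : Fin n)
    (y : EuclideanSpace ℝ (Fin n)) :
    HasLineDerivAt ℝ (fun y : EuclideanSpace ℝ (Fin n) => y i * posWeight v y)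
      ((2 * v i + 1) * posWeight v y) y (EuclideanSpace.single i 1) := by
  have hvi := hv i
  let P : ℝ := ∏ j ∈ Finset.univ.erase i, max (y j) 0 ^ (2 * v j)
  have hfun : ∀ t : ℝ, (y + t • EuclideanSpace.single i (1 : ℝ)) i *
      posWeight v (y + t • EuclideanSpace.single i 1) = max (y i + t) 0 ^ (2 * v i + 1) * P := by
    intro t
    rw [posWeight, ← Finset.mul_prod_erase _ _ (Finset.mem_univ i)]
    have h1 : ∏ j ∈ Finset.univ.erase i,
        max ((y + t • EuclideanSpace.single i (1 : ℝ)) j) 0 ^ (2 * v j) = P :=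
      Finset.prod_congr rfl fun j hj => by simp [Finset.ne_of_mem_erase hj]
    have h2 : (y + t • EuclideanSpace.single i (1 : ℝ)) i = y i + t := by simp
    rw [h1, h2, ← mul_assoc]
    congr 1
    rcases le_or_gt (y i + t) 0 with h | h
    · rw [max_eq_right h, zero_rpow (by positivity), zero_rpow (by positivity), mul_zero]
    · rw [max_eq_left h.le, rpow_add_one h.ne', mul_comm]
  have h0 : posWeight v y = max (y i) 0 ^ (2 * v i) * P := by
    rw [posWeight, ← Finset.mul_prod_erase _ _ (Finset.mem_univ i)]
  unfold HasLineDerivAt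
  simp only [hfun]
  have h := ((hasDerivAt_max_zero_rpow (r := 2 * v i + 1) (by linarith) (y i + 0)).comp_const_add
    (y i) 0).mul_const P
  refine h.congr_deriv ?_
  rw [add_zero, add_sub_cancel_right, h0]
  ring

theorem partialCLM_partialCLM_eq (i : Fin n) (φ : EvenSchwartz n)
    (x : EuclideanSpace ℝ (Fin n)) :
    partialCLM i (partialCLM i φ.1) x =
      (divDeriv i φ).1 x + x i * partialCLM i (divDeriv i φ).1 x := by
  have h : ⇑(partialCLM i φ.1) = fun y => (y i : ℂ) * (divDeriv i φ).1 y :=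
    funext fun y => (coord_mul_divDeriv i φ y).symm
  rw [partialCLM_apply, h,
    ((hasFDerivAt_coord i x).fun_mul ((divDeriv i φ).1.hasFDerivAt x)).fderiv, partialCLM_apply]
  simp [add_comm]

/-- With `∂ᵢ φ = xᵢ ψ`, the operator is free of singular terms. -/
theorem besselTest_apply' (v : Fin n → ℝ) (i : Fin n) (φ : EvenSchwartz n)
    (x : EuclideanSpace ℝ (Fin n)) : (besselTest v i φ).1 x =
      (2 * v i + 1) * (divDeriv i φ).1 x + x i * partialCLM i (divDeriv i φ).1 x := by
  rw [besselTest_apply, partialCLM_partialCLM_eq]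
  ring

theorem hasLineDerivAt_fbKernel_right {v : Fin n → ℝ} (hv : ∀ i, 0 < v i) (i : Fin n)
    (x y : EuclideanSpace ℝ (Fin n)) :
    HasLineDerivAt ℝ (fun y => (fbKernel v x y : ℂ))
      (-(y i * (x i : ℂ) ^ 2 / (2 * v i + 1)) * fbKernel (bump v i) x y) y
      (EuclideanSpace.single i 1) := by
  have h := (Complex.ofRealCLM.hasFDerivAt.comp y (hasFDerivAt_fbKernel hv y x)).hasLineDerivAt
    (EuclideanSpace.single i 1)
  simp only [Function.comp_def, fbKernel_comm v _ x, ContinuousLinearMap.comp_apply,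
    fbKernelDeriv_single, Complex.ofRealCLM_apply] at h
  rw [fbKernel_comm] at h
  have he : (-(y i * (x i : ℂ) ^ 2 / (2 * v i + 1)) * fbKernel (bump v i) x y : ℂ) =
      ((-(y i * x i ^ 2 / (2 * v i + 1)) * fbKernel (bump v i) x y : ℝ) : ℂ) := by
    push_cast
    ring
  rw [he]
  exact h

theorem integral_eq_zero_of_hasLineDerivAt {f f' : EuclideanSpace ℝ (Fin n) → ℂ}
    {e : EuclideanSpace ℝ (Fin n)} (hf : Integrable f) (hf' : Integrable f')
    (h : ∀ x, HasLineDerivAt ℝ f (f' x) x e) : ∫ x, f' x = 0 := by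
  have := integral_bilinear_hasLineDerivAt_right_eq_neg_left_of_integrable (μ := volume)
    (B := ContinuousLinearMap.mul ℝ ℂ) (f := fun _ : EuclideanSpace ℝ (Fin n) => (1 : ℂ))
    (f' := fun _ => 0) (g := f) (g' := f') (v := e) (by simp) (by simpa using hf')
    (by simpa using hf)
    (fun x _ => by simpa [HasLineDerivAt] using hasDerivAt_const (0 : ℝ) (1 : ℂ))
    (fun x _ => h x)
  simpa using this

/-- The transform turns the Bessel operator into multiplication by `-xᵢ²`. -/
theorem fbIntegral_besselTest {v : Fin n → ℝ} (hv : ∀ i, 0 < v i) (i : Fin n)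
    (φ : EvenSchwartz n) (x : EuclideanSpace ℝ (Fin n)) :
    fbIntegral v (besselTest v i φ).1 x = -((x i : ℂ) ^ 2 * fbIntegral v φ.1 x) := by
  have hvi := hv i
  have hb := bump_pos hv i
  have hbb := bump_pos hb i
  set ψ := divDeriv i φ with hψ
  have hn1 : (2 * v i + 1 : ℂ) ≠ 0 := by
    have : (2 * v i + 1 : ℝ) ≠ 0 := by positivity
    exact_mod_cast this
  have hn3 : (2 * v i + 3 : ℂ) ≠ 0 := by
    have : (2 * v i + 3 : ℝ) ≠ 0 := by positivity
    exact_mod_cast this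
  set c : ℂ := (x i : ℂ) ^ 2 / (2 * v i + 1) with hc
  -- With `K` the kernel, `yᵢ H = ∂ᵢφ · K - φ · ∂ᵢK`, because `∂ᵢφ = yᵢ ψ` and `∂ᵢK = -c yᵢ` times
  -- the raised kernel. Thus `h` is the flux in Green's formula for the weighted operator, and `h'`
  -- is its derivative, in which the Bessel equation has replaced `B K` by `-xᵢ² K`.
  let H : EuclideanSpace ℝ (Fin n) → ℂ := fun y =>
    ψ.1 y * (fbKernel v x y : ℂ) + c * (φ.1 y * (fbKernel (bump v i) x y : ℂ))
  let h : EuclideanSpace ℝ (Fin n) → ℂ := fun y => ((y i * posWeight v y : ℝ) : ℂ) * H y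
  let h' : EuclideanSpace ℝ (Fin n) → ℂ := fun y => (posWeight v y : ℂ) *
    ((besselTest v i φ).1 y * (fbKernel v x y : ℂ) +
      (x i : ℂ) ^ 2 * (φ.1 y * (fbKernel v x y : ℂ)))
  have hder : ∀ y, HasLineDerivAt ℝ h (h' y) y (EuclideanSpace.single i 1) := by
    intro y
    have d1 : HasDerivAt (fun t : ℝ => (((y + t • EuclideanSpace.single i (1 : ℝ)) i *
        posWeight v (y + t • EuclideanSpace.single i 1) : ℝ) : ℂ))
        (((2 * v i + 1) * posWeight v y : ℝ) : ℂ) 0 :=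
      HasDerivAt.ofReal_comp (hasLineDerivAt_coord_mul_posWeight hv i y)
    have d2 := (ψ.1.hasFDerivAt y).hasLineDerivAt (EuclideanSpace.single i 1)
    have d3 := (φ.1.hasFDerivAt y).hasLineDerivAt (EuclideanSpace.single i 1)
    have d4 := hasLineDerivAt_fbKernel_right hv i x y
    have d5 := hasLineDerivAt_fbKernel_right hb i x y
    rw [← partialCLM_apply] at d2 d3
    unfold HasLineDerivAt at d2 d3 d4 d5 ⊢
    have d := d1.fun_mul ((d2.fun_mul d4).fun_add ((d3.fun_mul d5).const_mul c))
    refine d.congr_deriv ?_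
    -- Three orders of the kernel occur in the derivative; the recurrence eliminates the lowest one.
    have hr : (fbKernel v x y : ℂ) = fbKernel (bump v i) x y -
        (x i * y i : ℂ) ^ 2 / ((2 * v i + 1) * (2 * v i + 3)) *
          fbKernel (bump (bump v i) i) x y := by
      exact_mod_cast congrArg (fun r : ℝ => (r : ℂ)) (fbKernel_recurrence hv i x y)
    have hφ : partialCLM i φ.1 y = y i * ψ.1 y := (coord_mul_divDeriv i φ y).symm
    simp only [h', besselTest_apply', ← hψ, zero_smul, add_zero, bump_self, hφ, hr, hc]
    rw [show (2 * ((v i + 1 : ℝ) : ℂ) + 1) = 2 * v i + 3 by push_cast; ring]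
    push_cast
    field_simp
    ring
  have hint1 : ∀ f : 𝓢(EuclideanSpace ℝ (Fin n), ℂ), Integrable
      (fun y => f y * (fbKernel v x y : ℂ)) (besselMeasure v) := fun f =>
    integrable_mul_fbKernel hv (integrable_schwartz hv f) x
  have hint2 : ∀ f : 𝓢(EuclideanSpace ℝ (Fin n), ℂ), Integrable
      (fun y => f y * (fbKernel (bump v i) x y : ℂ)) (besselMeasure v) := fun f =>
    integrable_mul_fbKernel hb (integrable_schwartz hv f) x
  have hh : Integrable h := by
    have := (integrable_besselMeasure_iff v).mp
      ((hint1 (coordCLM i ψ.1)).add ((hint2 (coordCLM i φ.1)).const_mul c))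
    refine this.congr (Eventually.of_forall fun y => ?_)
    simp only [h, H, coordCLM_apply, Pi.add_apply]
    push_cast
    ring
  have hh' : Integrable h' := (integrable_besselMeasure_iff v).mp
    ((hint1 (besselTest v i φ).1).add ((hint1 φ.1).const_mul ((x i : ℂ) ^ 2)))
  have hz := integral_eq_zero_of_hasLineDerivAt hh hh' hder
  rw [← integral_besselMeasure, integral_add (hint1 _) ((hint1 φ.1).const_mul _),
    integral_const_mul] at hz
  rw [fbIntegral_eq hv, fbIntegral_eq hv]
  linear_combination (fbConst v : ℂ) * hz

/-! ### Continuity of the transform on test functions. -/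

theorem HasTemperateGrowth.fderiv_apply {a : EuclideanSpace ℝ (Fin n) → ℂ}
    (ha : Function.HasTemperateGrowth a) (e : EuclideanSpace ℝ (Fin n)) :
    Function.HasTemperateGrowth fun x => fderiv ℝ a x e := by
  have h1 : Function.HasTemperateGrowth (fderiv ℝ a) := by
    refine ⟨ha.1.fderiv_right (by simp), fun m => ?_⟩
    obtain ⟨k, C, h⟩ := ha.2 (m + 1)
    exact ⟨k, C, fun x => by rw [norm_iteratedFDeriv_fderiv]; exact h x⟩
  exact (ContinuousLinearMap.apply ℝ ℂ e).hasTemperateGrowth.comp h1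

/-- The Schwartz family of the Fourier–Bessel integrals with coefficients of temperate growth. -/
def fbFamily (n : ℕ) : Set (EvenSchwartz n → EuclideanSpace ℝ (Fin n) → ℂ) :=
  {T | ∃ (v : Fin n → ℝ) (a : EuclideanSpace ℝ (Fin n) → ℂ)
    (L : EvenSchwartz n →L[ℂ] EvenSchwartz n), (∀ i, 0 < v i) ∧ Function.HasTemperateGrowth a ∧
      T = fun φ x => a x * fbIntegral v (L φ).1 x}

/-- Smoothness of `φ` becomes decay of its transform: this gains a factor `(1 + ‖x‖²)^k`, enough to
beat any coefficient of temperate growth. -/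
theorem fbIntegral_one_sub_besselTest_pow {v : Fin n → ℝ} (hv : ∀ i, 0 < v i) (k : ℕ)
    (φ : EvenSchwartz n) (x : EuclideanSpace ℝ (Fin n)) :
    fbIntegral v (((1 - ∑ i, besselTest v i) ^ k) φ).1 x =
      (1 + (‖x‖ : ℂ) ^ 2) ^ k * fbIntegral v φ.1 x := by
  induction k with
  | zero => simp
  | succ k ih =>
    rw [pow_succ', mul_apply_eq_comp, pow_succ', mul_assoc, ← ih]
    set ψ := ((1 - ∑ i, besselTest v i) ^ k) φ
    have h1 : ((1 - ∑ i, besselTest v i) ψ).1 = ψ.1 - ∑ i, (besselTest v i ψ).1 := by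
      rw [_root_.sub_apply, _root_.sum_apply]
      simp
    have h2 : ∀ f : 𝓢(EuclideanSpace ℝ (Fin n), ℂ), fbIntegral v f x = fbLinear hv f x :=
      fun f => rfl
    rw [h1, h2, map_sub, map_sum, Pi.sub_apply, Finset.sum_apply]
    simp only [← h2, fbIntegral_besselTest hv, Finset.sum_neg_distrib, ← Finset.sum_mul]
    have h3 : (‖x‖ : ℂ) ^ 2 = ∑ i, (x i : ℂ) ^ 2 := by
      exact_mod_cast congrArg (fun r : ℝ => (r : ℂ)) (EuclideanSpace.real_norm_sq_eq x)
    rw [h3]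
    ring

/-- Coordinates are absorbed by the coefficient `a`. Derivatives fall on `a` or raise one exponent,
which is why the family contains all positive exponents. -/
theorem isSchwartzFamily_fbFamily (n : ℕ) : IsSchwartzFamily (fbFamily n) where
  bound := by
    rintro T ⟨v, a, L, hv, ha, rfl⟩
    obtain ⟨k, C, hC⟩ := ha.2 0
    obtain ⟨p, hp, hle⟩ := exists_seminorm_fbIntegral_le hv
    let M : EvenSchwartz n →L[ℂ] 𝓢(EuclideanSpace ℝ (Fin n), ℂ) :=
      (EvenSchwartz n).subtypeL.comp (((1 - ∑ i, besselTest v i) ^ k).comp L)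
    have hC0 : 0 ≤ C := by
      have := (norm_nonneg _).trans (hC 0)
      simpa using this
    refine ⟨(C * 2 ^ k).toNNReal • p.comp M.toLinearMap,
      (hp.comp M.continuous).const_smul (C * 2 ^ k).toNNReal, fun φ x => ?_⟩
    have h1 : ((C * 2 ^ k).toNNReal • p.comp M.toLinearMap) φ = C * 2 ^ k * p (M φ) := by
      change ((C * 2 ^ k).toNNReal : ℝ) * p (M φ) = _
      rw [coe_toNNReal _ (by positivity)]
    have h2 := hle (M φ) x
    have h3 : fbIntegral v (M φ) x = (1 + (‖x‖ : ℂ) ^ 2) ^ k * fbIntegral v (L φ).1 x :=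
      fbIntegral_one_sub_besselTest_pow hv k (L φ) x
    have h4 : ‖(1 + (‖x‖ : ℂ) ^ 2)‖ = 1 + ‖x‖ ^ 2 := by
      rw [← Complex.ofReal_one, ← Complex.ofReal_pow, ← Complex.ofReal_add, Complex.norm_real,
        norm_of_nonneg (by positivity)]
    rw [h3, norm_mul, norm_pow, h4] at h2
    rw [h1, norm_mul]
    have h5 : ‖a x‖ ≤ C * (1 + ‖x‖) ^ k := by simpa using hC x
    calc ‖a x‖ * ‖fbIntegral v (L φ).1 x‖
        ≤ (C * (2 * (1 + ‖x‖ ^ 2)) ^ k) * ‖fbIntegral v (L φ).1 x‖ := by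
          -- Uses `1 + r ≤ 2 (1 + r²)`, the source of the constant `2 ^ k`.
          gcongr
          refine h5.trans ?_
          gcongr
          nlinarith [sq_nonneg (‖x‖ - 1)]
      _ = C * 2 ^ k * ((1 + ‖x‖ ^ 2) ^ k * ‖fbIntegral v (L φ).1 x‖) := by rw [mul_pow]; ring
      _ ≤ _ := by gcongr
  differentiable := by
    rintro T ⟨v, a, L, hv, ha, rfl⟩ φ x
    exact (ha.1.differentiable (by simp) x).fun_mul (fderiv_fbIntegral hv (L φ).1 x).1
  coord_mul := by
    rintro T ⟨v, a, L, hv, ha, rfl⟩ j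
    refine Submodule.subset_span ⟨v, fun x => x j * a x, L, hv,
      (hasTemperateGrowth_coord j).mul ha, ?_⟩
    ext φ x
    ring
  partialDeriv := by
    rintro T ⟨v, a, L, hv, ha, rfl⟩ j
    have h1 : (fun (φ : EvenSchwartz n) x => (fderiv ℝ a x (EuclideanSpace.single j 1)) *
        fbIntegral v (L φ).1 x) ∈ Submodule.span ℂ (fbFamily n) :=
      Submodule.subset_span ⟨v, _, L, hv, HasTemperateGrowth.fderiv_apply ha _, rfl⟩
    have h2 : (fun (φ : EvenSchwartz n) (x : EuclideanSpace ℝ (Fin n)) => ((x j : ℂ) * a x) *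
        fbIntegral (bump v j) (L φ).1 x) ∈ Submodule.span ℂ (fbFamily n) :=
      Submodule.subset_span ⟨bump v j, fun x => x j * a x, L, bump_pos hv j,
        (hasTemperateGrowth_coord j).mul ha, rfl⟩
    convert Submodule.sub_mem _ h1 h2 using 1
    ext φ x
    have hd := fderiv_fbIntegral hv (L φ).1 x
    rw [((ha.1.differentiable (by simp) x).hasFDerivAt.fun_mul hd.1.hasFDerivAt).fderiv]
    simp only [_root_.add_apply, _root_.smul_apply, smul_eq_mul, hd.2 j, Pi.sub_apply]
    ring

theorem fbIntegral_eq_of_signRel {v : Fin n → ℝ} (hv : ∀ i, 0 < v i)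
    (f : EuclideanSpace ℝ (Fin n) → ℂ) {x y : EuclideanSpace ℝ (Fin n)} (h : SignRel x y) :
    fbIntegral v f x = fbIntegral v f y := by
  simp only [fbIntegral_eq hv, fbKernel_eq_of_signRel v h]

theorem exists_fbTest {v : Fin n → ℝ} (hv : ∀ i, 0 < v i) :
    ∃ F : EvenSchwartz n →L[ℂ] EvenSchwartz n, ∀ φ x, (F φ).1 x = fbIntegral v φ.1 x := by
  obtain ⟨Q, hQ⟩ := (isSchwartzFamily_fbFamily n).exists_clm
    ((fbLinear hv).comp (EvenSchwartz n).subtype)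
    (Submodule.subset_span ⟨v, fun _ => 1, ContinuousLinearMap.id ℂ _, hv,
      Function.HasTemperateGrowth.const 1, by ext; simp [fbLinear]⟩)
  have hmem : ∀ φ, Q φ ∈ EvenSchwartz n := by
    intro φ x y h
    rw [hQ, hQ]
    exact fbIntegral_eq_of_signRel hv _ h
  exact ⟨Q.codRestrict (EvenSchwartz n) hmem, fun φ x => hQ φ x⟩

/-- The Fourier–Bessel transform of the test functions. -/
def fbTest {v : Fin n → ℝ} (hv : ∀ i, 0 < v i) : EvenSchwartz n →L[ℂ] EvenSchwartz n :=
  (exists_fbTest hv).choose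

theorem fbTest_apply {v : Fin n → ℝ} (hv : ∀ i, 0 < v i) (φ : EvenSchwartz n)
    (x : EuclideanSpace ℝ (Fin n)) : (fbTest hv φ).1 x = fbIntegral v φ.1 x :=
  (exists_fbTest hv).choose_spec φ x

theorem realizes_fbTest {v : Fin n → ℝ} (hv : ∀ i, 0 < v i) :
    Realizes (fbIntegral v) (fbTest hv) :=
  fun φ x _ => fbTest_apply hv φ x

theorem fbInvIntegral_eq {v : Fin n → ℝ} (hv : ∀ i, 0 < v i) :
    (fbInvIntegral v : (EuclideanSpace ℝ (Fin n) → ℂ) → _) = fbIntegral v := by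
  ext f x
  exact fbIntegral_eq_of_signRel hv f fun i => Or.inr rfl

/-! ### The Bessel operator applied to a transform. -/

/-- Multiplication by `xᵢ²` on the test functions. -/
def coordSqTest (i : Fin n) : EvenSchwartz n →L[ℂ] EvenSchwartz n :=
  ((coordCLM i).comp ((coordCLM i).comp (EvenSchwartz n).subtypeL)).codRestrict (EvenSchwartz n)
    (by
      intro φ x y h
      simp only [ContinuousLinearMap.comp_apply, coordCLM_apply, Submodule.subtypeL_apply,
        φ.2 x y h]
      rcases h i with h | h <;> simp [h])

theorem coordSqTest_apply (i : Fin n) (φ : EvenSchwartz n) (x : EuclideanSpace ℝ (Fin n)) :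
    (coordSqTest i φ).1 x = (x i : ℂ) ^ 2 * φ.1 x := by
  rw [pow_two, mul_assoc, ← coordCLM_apply, ← coordCLM_apply]
  rfl

theorem divDeriv_fbTest {v : Fin n → ℝ} (hv : ∀ i, 0 < v i) (i : Fin n) (φ : EvenSchwartz n) :
    divDeriv i (fbTest hv φ) = -fbTest (bump_pos hv i) φ := by
  refine EvenSchwartz.ext_orthant fun x hx => ?_
  have hx' : (x i : ℂ) ≠ 0 := by exact_mod_cast (hx i).ne'
  apply mul_left_cancel₀ hx'
  rw [coord_mul_divDeriv, partialCLM_apply,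
    show ⇑(fbTest hv φ).1 = fbIntegral v φ.1 from funext (fbTest_apply hv φ),
    (fderiv_fbIntegral hv φ.1 x).2 i, Submodule.coe_neg, _root_.neg_apply, fbTest_apply]
  ring

/-- The Bessel operator of a transform is the transform of a multiple by `-xᵢ²`. -/
theorem besselTest_fbTest {v : Fin n → ℝ} (hv : ∀ i, 0 < v i) (i : Fin n) (φ : EvenSchwartz n) :
    besselTest v i (fbTest hv φ) = -fbTest hv (coordSqTest i φ) := by
  have hvi := hv i
  have hb := bump_pos hv i
  have hbb := bump_pos hb i
  apply Subtype.ext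
  ext x
  have hn1 : (2 * v i + 1 : ℂ) ≠ 0 := by
    have : (2 * v i + 1 : ℝ) ≠ 0 := by positivity
    exact_mod_cast this
  have hn3 : (2 * v i + 3 : ℂ) ≠ 0 := by
    have : (2 * v i + 3 : ℝ) ≠ 0 := by positivity
    exact_mod_cast this
  -- With `D = (1/xᵢ) ∂ᵢ` the Bessel operator is `(2vᵢ + 1) D + xᵢ² D²`. Each `D` raises the
  -- exponent in the transform and changes the sign. All integrals are then brought back to the
  -- measure of `v`, where the kernel recurrence closes the identity.
  rw [besselTest_apply', ← coord_mul_divDeriv i (divDeriv i (fbTest hv φ)), divDeriv_fbTest,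
    map_neg, divDeriv_fbTest hb, neg_neg, Submodule.coe_neg, Submodule.coe_neg, _root_.neg_apply,
    _root_.neg_apply, fbTest_apply, fbTest_apply, fbTest_apply, fbIntegral_eq hv,
    fbIntegral_eq hb, fbIntegral_eq hbb, integral_besselMeasure_bump hb,
    integral_besselMeasure_bump hv, integral_besselMeasure_bump hv, ← fbConst_bump hv i,
    ← fbConst_bump hb i, bump_self]
  simp only [coordSqTest_apply]
  have hr : ∀ y, (y i : ℂ) ^ 2 * φ.1 y * (fbKernel v x y : ℂ) =
      (y i : ℂ) ^ 2 * (φ.1 y * (fbKernel (bump v i) x y : ℂ)) -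
        (x i : ℂ) ^ 2 / ((2 * v i + 1) * (2 * v i + 3)) * ((y i : ℂ) ^ 2 * ((y i : ℂ) ^ 2 *
          (φ.1 y * (fbKernel (bump (bump v i) i) x y : ℂ)))) := by
    intro y
    have hr : (fbKernel v x y : ℂ) = fbKernel (bump v i) x y -
        (x i * y i : ℂ) ^ 2 / ((2 * v i + 1) * (2 * v i + 3)) *
          fbKernel (bump (bump v i) i) x y := by
      exact_mod_cast congrArg (fun r : ℝ => (r : ℂ)) (fbKernel_recurrence hv i x y)
    rw [hr]
    ring
  have hi1 : Integrable (fun y => (y i : ℂ) ^ 2 * (φ.1 y * (fbKernel (bump v i) x y : ℂ)))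
      (besselMeasure v) := by
    refine (integrable_mul_fbKernel hb (integrable_schwartz hv (coordSqTest i φ).1) x).congr
      (Eventually.of_forall fun y => ?_)
    simp only [coordSqTest_apply]
    ring
  have hi2 : Integrable (fun y => (y i : ℂ) ^ 2 * ((y i : ℂ) ^ 2 *
      (φ.1 y * (fbKernel (bump (bump v i) i) x y : ℂ)))) (besselMeasure v) := by
    refine (integrable_mul_fbKernel hbb
      (integrable_schwartz hv (coordSqTest i (coordSqTest i φ)).1) x).congr
      (Eventually.of_forall fun y => ?_)
    simp only [coordSqTest_apply]
    ring
  simp only [hr]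
  rw [integral_sub hi1 (hi2.const_mul _), integral_const_mul]
  push_cast
  field_simp
  ring

/-! ### Gaussians and inversion at the origin. -/

/-- The Gaussian `exp (-b ‖x‖² / 2)`. -/
def gauss (b : ℝ) (x : EuclideanSpace ℝ (Fin n)) : ℝ := exp (-b * ‖x‖ ^ 2 / 2)

theorem continuous_gauss (b : ℝ) : Continuous (gauss b : EuclideanSpace ℝ (Fin n) → ℝ) := by
  unfold gauss
  fun_prop

theorem gauss_eq_prod (b : ℝ) (x : EuclideanSpace ℝ (Fin n)) :
    gauss b x = ∏ i, exp (-b * x i ^ 2 / 2) := by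
  rw [gauss, EuclideanSpace.real_norm_sq_eq, ← exp_sum, Finset.mul_sum, Finset.sum_div]

theorem integral_euclidean_prod (f : Fin n → ℝ → ℝ) :
    ∫ x : EuclideanSpace ℝ (Fin n), ∏ i, f i (x i) = ∏ i, ∫ s, f i s := by
  rw [← integral_fintype_prod_volume_eq_prod]
  exact (EuclideanSpace.volume_preserving_symm_measurableEquiv_toLp (Fin n)).integral_comp'
    (fun z : Fin n → ℝ => ∏ i, f i (z i))

/-- The Fourier–Bessel integral of a Gaussian. -/
theorem integral_gauss_mul_fbKernel {v : Fin n → ℝ} (hv : ∀ i, 0 < v i) {b : ℝ} (hb : 0 < b)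
    (y : EuclideanSpace ℝ (Fin n)) :
    ∫ x, (gauss b x : ℂ) * (fbKernel v y x : ℂ) ∂besselMeasure v =
      (((fbConst v)⁻¹ * (b ^ (-∑ i, (v i + 1 / 2)) * gauss b⁻¹ y) : ℝ) : ℂ) := by
  let f : Fin n → ℝ → ℝ := fun i s =>
    max s 0 ^ (2 * v i) * (exp (-b * s ^ 2 / 2) * normalizedBessel (v i - 1 / 2) (y i * s))
  have h1 : ∀ i, ∫ s, f i s = 2 ^ (v i - 1 / 2) * Gamma (v i + 1 / 2) *
      (b ^ (-(v i + 1 / 2)) * exp (-b⁻¹ * y i ^ 2 / 2)) := by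
    intro i
    have hvi := hv i
    rw [← setIntegral_eq_integral_of_forall_compl_eq_zero (s := Ioi 0)]
    · rw [show -b⁻¹ * y i ^ 2 / 2 = -y i ^ 2 / (2 * b) by field_simp,
        ← integral_gaussian_mul_normalizedBessel hvi hb]
      refine setIntegral_congr_fun measurableSet_Ioi fun s hs => ?_
      simp only [f]
      rw [max_eq_left (le_of_lt hs)]
      ring
    · intro s hs
      simp only [f]
      rw [max_eq_right (not_lt.mp hs), zero_rpow (by positivity), zero_mul]
  rw [integral_besselMeasure]
  have h2 : ∀ x, (posWeight v x : ℂ) * ((gauss b x : ℂ) * (fbKernel v y x : ℂ)) =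
      ((∏ i, f i (x i) : ℝ) : ℂ) := by
    intro x
    simp only [f]
    rw [Finset.prod_mul_distrib, Finset.prod_mul_distrib, ← gauss_eq_prod]
    push_cast
    simp only [posWeight, fbKernel]
    push_cast
    ring
  simp only [h2]
  rw [integral_complex_ofReal, integral_euclidean_prod]
  congr 1
  simp only [h1]
  rw [gauss_eq_prod, fbConst, inv_inv, ← Finset.sum_neg_distrib, rpow_sum_of_pos hb,
    ← Finset.prod_mul_distrib, ← Finset.prod_mul_distrib]

theorem integral_gauss {v : Fin n → ℝ} (hv : ∀ i, 0 < v i) {b : ℝ} (hb : 0 < b) :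
    ∫ x, (gauss b x : ℂ) ∂besselMeasure v =
      (((fbConst v)⁻¹ * b ^ (-∑ i, (v i + 1 / 2)) : ℝ) : ℂ) := by
  have h := integral_gauss_mul_fbKernel hv hb 0
  simpa [fbKernel_zero_left hv, gauss] using h

/-- Its integral is known to be nonzero, whereas a non-integrable function would have integral zero
by convention. -/
theorem integrable_gauss {v : Fin n → ℝ} (hv : ∀ i, 0 < v i) {b : ℝ} (hb : 0 < b) :
    Integrable (fun x => (gauss b x : ℂ)) (besselMeasure v) := by
  by_contra h
  have h0 := integral_undef h
  rw [integral_gauss hv hb, Complex.ofReal_eq_zero] at h0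
  have := fbConst_pos hv
  have h1 : 0 < (fbConst v)⁻¹ * b ^ (-∑ i, (v i + 1 / 2)) := by positivity
  exact h1.ne' h0

theorem posWeight_smul (v : Fin n → ℝ) {r : ℝ} (hr : 0 < r) (x : EuclideanSpace ℝ (Fin n)) :
    posWeight v (r • x) = r ^ (∑ i, 2 * v i) * posWeight v x := by
  rw [posWeight, posWeight, rpow_sum_of_pos hr, ← Finset.prod_mul_distrib]
  refine Finset.prod_congr rfl fun i _ => ?_
  rw [PiLp.smul_apply, smul_eq_mul, ← mul_rpow hr.le (le_max_right _ _),
    mul_max_of_nonneg _ _ hr.le, mul_zero]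

/-- The weight is homogeneous of degree `∑ 2vᵢ` and Lebesgue measure contributes `n`; together they
give `2 ∑ (vᵢ + 1/2)`. -/
theorem integral_besselMeasure_comp_smul (v : Fin n → ℝ) {r : ℝ} (hr : 0 < r)
    (f : EuclideanSpace ℝ (Fin n) → ℂ) :
    ∫ x, f x ∂besselMeasure v =
      ((r ^ (2 * ∑ i, (v i + 1 / 2)) : ℝ) : ℂ) * ∫ x, f (r • x) ∂besselMeasure v := by
  rw [integral_besselMeasure, integral_besselMeasure]
  have h := Measure.integral_comp_smul volume
    (fun x : EuclideanSpace ℝ (Fin n) => (posWeight v x : ℂ) * f x) r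
  simp only [posWeight_smul v hr] at h
  have h1 : ∀ x, ((r ^ (∑ i, 2 * v i) * posWeight v x : ℝ) : ℂ) * f (r • x) =
      ((r ^ (∑ i, 2 * v i) : ℝ) : ℂ) * ((posWeight v x : ℂ) * f (r • x)) := fun x => by
    push_cast
    ring
  simp only [h1] at h
  have hrn : 0 < r ^ n := pow_pos hr n
  rw [integral_const_mul, finrank_euclideanSpace_fin, abs_of_pos (by positivity),
    Complex.real_smul] at h
  have h2 : r ^ (2 * ∑ i, (v i + 1 / 2)) = r ^ n * r ^ (∑ i, 2 * v i) := by
    rw [← rpow_natCast, ← rpow_add hr, Finset.mul_sum]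
    congr 1
    simp only [mul_add]
    rw [Finset.sum_add_distrib]
    simp [add_comm]
  rw [h2, Complex.ofReal_mul, mul_assoc, h, ← mul_assoc, ← Complex.ofReal_mul,
    mul_inv_cancel₀ hrn.ne', Complex.ofReal_one, one_mul]

theorem gauss_nonneg (b : ℝ) (x : EuclideanSpace ℝ (Fin n)) : 0 ≤ gauss b x := (exp_pos _).le

theorem gauss_le_one {b : ℝ} (hb : 0 ≤ b) (x : EuclideanSpace ℝ (Fin n)) : gauss b x ≤ 1 := by
  rw [gauss, exp_le_one_iff]
  have : 0 ≤ b * ‖x‖ ^ 2 := by positivity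
  linarith

instance (v : Fin n → ℝ) : SFinite (besselMeasure v) := by
  unfold besselMeasure
  infer_instance

/-- Fubini moves the transform from `f` to the Gaussian, whose transform is the Gaussian of inverse
parameter. The substitution `y = r x` then cancels every power of `r`. -/
theorem integral_fbIntegral_mul_gauss {v : Fin n → ℝ} (hv : ∀ i, 0 < v i)
    (f : 𝓢(EuclideanSpace ℝ (Fin n), ℂ)) {r : ℝ} (hr : 0 < r) :
    ∫ x, fbIntegral v f x * (gauss (r ^ 2) x : ℂ) ∂besselMeasure v =
      ∫ x, f (r • x) * (gauss 1 x : ℂ) ∂besselMeasure v := by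
  have hr2 : 0 < r ^ 2 := by positivity
  have hint : Integrable (Function.uncurry fun x y : EuclideanSpace ℝ (Fin n) =>
      (gauss (r ^ 2) x : ℂ) * f y * (fbKernel v x y : ℂ))
      ((besselMeasure v).prod (besselMeasure v)) := by
    refine ((integrable_gauss hv hr2).mul_prod (integrable_schwartz hv f)).mul_bdd (c := 1)
      (Complex.continuous_ofReal.comp (continuous_fbKernel hv)).aestronglyMeasurable
      (Eventually.of_forall fun p => ?_)
    rw [Complex.norm_real]
    exact abs_fbKernel_le_one hv p.1 p.2
  have h1 : ∀ x, fbIntegral v f x * (gauss (r ^ 2) x : ℂ) = fbConst v *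
      ∫ y, (gauss (r ^ 2) x : ℂ) * f y * (fbKernel v x y : ℂ) ∂besselMeasure v := by
    intro x
    simp only [mul_assoc]
    rw [fbIntegral_eq hv, integral_const_mul]
    ring
  simp only [h1]
  rw [integral_const_mul, integral_integral_swap hint]
  have h2 : ∀ y, ∫ x, (gauss (r ^ 2) x : ℂ) * f y * (fbKernel v x y : ℂ) ∂besselMeasure v =
      (((fbConst v)⁻¹ * (r ^ 2) ^ (-∑ i, (v i + 1 / 2)) : ℝ) : ℂ) *
        (f y * (gauss (r ^ 2)⁻¹ y : ℂ)) := by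
    intro y
    have h3 : ∀ x, (gauss (r ^ 2) x : ℂ) * f y * (fbKernel v x y : ℂ) =
        f y * ((gauss (r ^ 2) x : ℂ) * (fbKernel v y x : ℂ)) := fun x => by
      rw [fbKernel_comm]
      ring
    simp only [h3]
    rw [integral_const_mul, integral_gauss_mul_fbKernel hv hr2]
    push_cast
    ring
  simp only [h2]
  rw [integral_const_mul, integral_besselMeasure_comp_smul v hr]
  have h4 : ∀ x : EuclideanSpace ℝ (Fin n), gauss (r ^ 2)⁻¹ (r • x) = gauss 1 x := by
    intro x
    rw [gauss, gauss, norm_smul, norm_of_nonneg hr.le]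
    congr 1
    field_simp
  have h5 : (r ^ 2) ^ (-∑ i, (v i + 1 / 2)) * r ^ (2 * ∑ i, (v i + 1 / 2)) = 1 := by
    rw [rpow_neg hr2.le, ← rpow_natCast, ← rpow_mul hr.le, Nat.cast_ofNat]
    exact inv_mul_cancel₀ (rpow_pos_of_pos hr _).ne'
  simp only [h4]
  rw [← mul_assoc, ← mul_assoc, ← Complex.ofReal_mul, ← Complex.ofReal_mul,
    show fbConst v * ((fbConst v)⁻¹ * (r ^ 2) ^ (-∑ i, (v i + 1 / 2))) *
      r ^ (2 * ∑ i, (v i + 1 / 2)) = (fbConst v * (fbConst v)⁻¹) *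
        ((r ^ 2) ^ (-∑ i, (v i + 1 / 2)) * r ^ (2 * ∑ i, (v i + 1 / 2))) by ring,
    h5, mul_inv_cancel₀ (fbConst_pos hv).ne']
  simp

theorem fbIntegral_zero {v : Fin n → ℝ} (hv : ∀ i, 0 < v i) (f : EuclideanSpace ℝ (Fin n) → ℂ) :
    fbIntegral v f 0 = fbConst v * ∫ x, f x ∂besselMeasure v := by
  simp [fbIntegral_eq hv, fbKernel_zero_left hv]

/-- The inversion formula at the origin. -/
theorem fbTest_fbTest_zero {v : Fin n → ℝ} (hv : ∀ i, 0 < v i) (φ : EvenSchwartz n) :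
    (fbTest hv (fbTest hv φ)).1 0 = φ.1 0 := by
  have hfun : ⇑(fbTest hv φ).1 = fbIntegral v φ.1 := funext (fbTest_apply hv φ)
  have hgauss : ∀ x : EuclideanSpace ℝ (Fin n), Continuous fun r : ℝ => gauss (r ^ 2) x := by
    intro x
    unfold gauss
    fun_prop
  -- As `r → 0⁺` the Gaussian `gauss (r ^ 2)` flattens to one and `φ (r • x)` tends to `φ 0`. Both
  -- limits are dominated; the first because `F φ` is itself a test function, hence integrable.
  have h1 : Tendsto (fun r : ℝ => ∫ x, fbIntegral v φ.1 x * (gauss (r ^ 2) x : ℂ) ∂besselMeasure v)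
      (𝓝[>] 0) (𝓝 (∫ x, fbIntegral v φ.1 x ∂besselMeasure v)) := by
    have hint := integrable_schwartz hv (fbTest hv φ).1
    rw [hfun] at hint
    refine tendsto_integral_filter_of_dominated_convergence (fun x => ‖fbIntegral v φ.1 x‖)
      (Eventually.of_forall fun r => ?_) (Eventually.of_forall fun r =>
        Eventually.of_forall fun x => ?_) hint.norm (Eventually.of_forall fun x => ?_)
    · exact hint.aestronglyMeasurable.mul
        (Complex.continuous_ofReal.comp (continuous_gauss _)).aestronglyMeasurable
    · rw [norm_mul, Complex.norm_real, norm_of_nonneg (gauss_nonneg _ _)]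
      exact mul_le_of_le_one_right (norm_nonneg _) (gauss_le_one (sq_nonneg r) x)
    · have := ((Complex.continuous_ofReal.comp (hgauss x)).const_mul (fbIntegral v φ.1 x)).tendsto 0
      simpa [gauss] using this.mono_left nhdsWithin_le_nhds
  have h2 : Tendsto (fun r : ℝ => ∫ x, φ.1 (r • x) * (gauss 1 x : ℂ) ∂besselMeasure v)
      (𝓝[>] 0) (𝓝 (∫ x, φ.1 0 * (gauss 1 x : ℂ) ∂besselMeasure v)) := by
    refine tendsto_integral_filter_of_dominated_convergence
      (fun x => SchwartzMap.seminorm ℂ 0 0 φ.1 * ‖(gauss 1 x : ℂ)‖)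
      (Eventually.of_forall fun r => ?_) (Eventually.of_forall fun r =>
        Eventually.of_forall fun x => ?_) ((integrable_gauss hv one_pos).norm.const_mul _)
      (Eventually.of_forall fun x => ?_)
    · exact ((φ.1.continuous.comp (continuous_const_smul r)).mul
        (Complex.continuous_ofReal.comp (continuous_gauss _))).aestronglyMeasurable
    · rw [norm_mul]
      exact mul_le_mul_of_nonneg_right (SchwartzMap.norm_le_seminorm ℂ φ.1 _) (norm_nonneg _)
    · have hc : Continuous fun r : ℝ => φ.1 (r • x) * (gauss 1 x : ℂ) :=
        (φ.1.continuous.comp (by fun_prop)).mul continuous_const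
      have := hc.tendsto 0
      rw [zero_smul] at this
      exact this.mono_left nhdsWithin_le_nhds
  have h3 : ∫ x, fbIntegral v φ.1 x ∂besselMeasure v =
      ∫ x, φ.1 0 * (gauss 1 x : ℂ) ∂besselMeasure v := by
    refine tendsto_nhds_unique h1 (h2.congr' ?_)
    filter_upwards [self_mem_nhdsWithin] with r hr
    exact (integral_fbIntegral_mul_gauss hv φ.1 hr).symm
  rw [fbTest_apply, hfun, fbIntegral_zero hv, h3, integral_const_mul, integral_gauss hv one_pos]
  have hC : (fbConst v : ℂ) ≠ 0 := by exact_mod_cast (fbConst_pos hv).ne'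
  simp
  field_simp

/-! ### Multiplication operators and transposes. -/

/-- The operator on test functions is multiplication by a function. -/
def IsMultiplication (M : EvenSchwartz n →L[ℂ] EvenSchwartz n)
    (g : EuclideanSpace ℝ (Fin n) → ℝ) : Prop := ∀ φ x, (M φ).1 x = g x * φ.1 x

namespace IsMultiplication

variable {M N : EvenSchwartz n →L[ℂ] EvenSchwartz n} {g h : EuclideanSpace ℝ (Fin n) → ℝ}

theorem sub (hM : IsMultiplication M g) (hN : IsMultiplication N h) :
    IsMultiplication (M - N) fun x => g x - h x := by
  intro φ x
  have : ((M - N) φ).1 x = (M φ).1 x - (N φ).1 x := rfl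
  rw [this, hM, hN]
  push_cast
  ring

theorem sum {ι : Type*} [Fintype ι] {M : ι → EvenSchwartz n →L[ℂ] EvenSchwartz n}
    {g : ι → EuclideanSpace ℝ (Fin n) → ℝ} (hM : ∀ i, IsMultiplication (M i) (g i)) :
    IsMultiplication (∑ i, M i) fun x => ∑ i, g i x := by
  intro φ x
  have : ((∑ i, M i) φ).1 x = ∑ i, (M i φ).1 x := by
    rw [_root_.sum_apply, Submodule.coe_sum, _root_.sum_apply]
  rw [this]
  simp only [hM _ φ x]
  push_cast
  rw [Finset.sum_mul]

theorem pow (hM : IsMultiplication M g) (k : ℕ) : IsMultiplication (M ^ k) fun x => g x ^ k := by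
  induction k with
  | zero => intro φ x; simp
  | succ k ih =>
    intro φ x
    rw [pow_succ', mul_apply_eq_comp, hM, ih]
    push_cast
    ring

end IsMultiplication

/-- The operator on distributions is the transpose of an operator on test functions. -/
def IsTranspose (A : EvenTempered n →L[ℂ] EvenTempered n)
    (L : EvenSchwartz n →L[ℂ] EvenSchwartz n) : Prop :=
  ∀ (T : EvenTempered n) (φ : EvenSchwartz n), A T φ = T (L φ)

namespace IsTranspose

variable {A B : EvenTempered n →L[ℂ] EvenTempered n} {L M : EvenSchwartz n →L[ℂ] EvenSchwartz n}

theorem sub (hA : IsTranspose A L) (hB : IsTranspose B M) : IsTranspose (A - B) (L - M) := by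
  intro T φ
  have : (A - B) T φ = A T φ - B T φ := rfl
  rw [this, hA, hB, _root_.sub_apply, map_sub]

theorem sum {ι : Type*} [Fintype ι] {A : ι → EvenTempered n →L[ℂ] EvenTempered n}
    {L : ι → EvenSchwartz n →L[ℂ] EvenSchwartz n} (hA : ∀ i, IsTranspose (A i) (L i)) :
    IsTranspose (∑ i, A i) (∑ i, L i) := by
  intro T φ
  have : (∑ i, A i) T φ = ∑ i, A i T φ := by
    rw [_root_.sum_apply, _root_.sum_apply]
  rw [this, _root_.sum_apply, map_sum]
  exact Finset.sum_congr rfl fun i _ => hA i T φ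

/-- Transposition reverses products, which does not matter for powers of a single operator. -/
theorem pow (hA : IsTranspose A L) (k : ℕ) : IsTranspose (A ^ k) (L ^ k) := by
  induction k with
  | zero => intro T φ; rfl
  | succ k ih =>
    intro T φ
    rw [pow_succ', mul_apply_eq_comp, hA, ih, pow_succ, mul_apply_eq_comp]

end IsTranspose

theorem isTranspose_onDist
    {A : (EuclideanSpace ℝ (Fin n) → ℂ) → EuclideanSpace ℝ (Fin n) → ℂ}
    {L : EvenSchwartz n →L[ℂ] EvenSchwartz n} (h : Realizes A L) : IsTranspose (onDist A) L := by
  intro T φ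
  rw [onDist, h.onTest_eq]
  rfl

/-! ### The diamond operator and its symbol. -/

/-- The Bessel diamond operator on test functions. -/
def diamondTest {p q : ℕ} (v : Fin (p + q) → ℝ) :
    EvenSchwartz (p + q) →L[ℂ] EvenSchwartz (p + q) :=
  (∑ i : Fin p, besselTest v (Fin.castAdd q i)) ^ 2
    - (∑ j : Fin q, besselTest v (Fin.natAdd p j)) ^ 2

/-- Multiplication by `diamondPoly` on test functions. -/
def diamondPolyTest (p q : ℕ) : EvenSchwartz (p + q) →L[ℂ] EvenSchwartz (p + q) :=
  (∑ i : Fin p, coordSqTest (Fin.castAdd q i)) ^ 2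
    - (∑ j : Fin q, coordSqTest (Fin.natAdd p j)) ^ 2

theorem isTranspose_diamondOp {p q : ℕ} (v : Fin (p + q) → ℝ) :
    IsTranspose (diamondOp v) (diamondTest v) :=
  ((IsTranspose.sum fun _ => isTranspose_onDist (realizes_besselTest v _)).pow 2).sub
    ((IsTranspose.sum fun _ => isTranspose_onDist (realizes_besselTest v _)).pow 2)

theorem isMultiplication_coordSqTest (i : Fin n) :
    IsMultiplication (coordSqTest i) fun x => x i ^ 2 := by
  intro φ x
  rw [coordSqTest_apply]
  push_cast
  rfl

theorem isMultiplication_diamondPolyTest (p q : ℕ) :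
    IsMultiplication (diamondPolyTest p q) diamondPoly :=
  ((IsMultiplication.sum fun _ => isMultiplication_coordSqTest _).pow 2).sub
    ((IsMultiplication.sum fun _ => isMultiplication_coordSqTest _).pow 2)

theorem semiconjBy_fbTest_besselTest {v : Fin n → ℝ} (hv : ∀ i, 0 < v i) (i : Fin n) :
    SemiconjBy (fbTest hv) (-coordSqTest i) (besselTest v i) := by
  ext1 φ
  rw [mul_apply_eq_comp, mul_apply_eq_comp, besselTest_fbTest, _root_.neg_apply, map_neg]

/-- Proved separately from the relation in the other direction, since one could be deduced from the
other only by full inversion. As semiconjugations, both pass formally to sums, differences and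
powers. -/
theorem semiconjBy_fbTest_coordSqTest {v : Fin n → ℝ} (hv : ∀ i, 0 < v i) (i : Fin n) :
    SemiconjBy (fbTest hv) (besselTest v i) (-coordSqTest i) := by
  ext1 φ
  rw [mul_apply_eq_comp, mul_apply_eq_comp, _root_.neg_apply]
  apply Subtype.ext
  ext x
  rw [Submodule.coe_neg, _root_.neg_apply, coordSqTest_apply, fbTest_apply, fbTest_apply,
    fbIntegral_besselTest hv]

theorem SemiconjBy.sum_right {R ι : Type*} [NonUnitalNonAssocSemiring R] [Fintype ι] {a : R}
    {b c : ι → R} (h : ∀ i, SemiconjBy a (b i) (c i)) : SemiconjBy a (∑ i, b i) (∑ i, c i) := by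
  simp only [SemiconjBy, Finset.mul_sum, Finset.sum_mul]
  exact Finset.sum_congr rfl fun i _ => h i

/-- Each Bessel operator corresponds to `-xᵢ²`; the squares in the diamond operator make the sign
disappear. -/
theorem diamondPolyTest_eq (p q : ℕ) : diamondPolyTest p q =
    (∑ i : Fin p, -coordSqTest (Fin.castAdd q i)) ^ 2
      - (∑ j : Fin q, -coordSqTest (Fin.natAdd p j)) ^ 2 := by
  rw [diamondPolyTest, Finset.sum_neg_distrib, Finset.sum_neg_distrib]
  have h : ∀ A : EvenSchwartz (p + q) →L[ℂ] EvenSchwartz (p + q), (-A) ^ 2 = A ^ 2 := fun A => by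
    ext1 φ
    rw [sq, sq, mul_apply_eq_comp, mul_apply_eq_comp, _root_.neg_apply, _root_.neg_apply, map_neg,
      neg_neg]
  exact congrArg₂ _ (h _).symm (h _).symm

theorem semiconjBy_fbTest_diamondTest {p q : ℕ} {v : Fin (p + q) → ℝ} (hv : ∀ i, 0 < v i) (k : ℕ) :
    SemiconjBy (fbTest hv) (diamondPolyTest p q ^ k) (diamondTest v ^ k) := by
  refine SemiconjBy.pow_right ?_ k
  rw [diamondPolyTest_eq]
  exact ((SemiconjBy.sum_right fun _ => semiconjBy_fbTest_besselTest hv _).pow_right 2).sub_right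
    ((SemiconjBy.sum_right fun _ => semiconjBy_fbTest_besselTest hv _).pow_right 2)

theorem semiconjBy_fbTest_diamondPolyTest {p q : ℕ} {v : Fin (p + q) → ℝ} (hv : ∀ i, 0 < v i)
    (k : ℕ) : SemiconjBy (fbTest hv) (diamondTest v ^ k) (diamondPolyTest p q ^ k) := by
  refine SemiconjBy.pow_right ?_ k
  rw [diamondPolyTest_eq]
  exact ((SemiconjBy.sum_right fun _ => semiconjBy_fbTest_coordSqTest hv _).pow_right 2).sub_right
    ((SemiconjBy.sum_right fun _ => semiconjBy_fbTest_coordSqTest hv _).pow_right 2)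

theorem delta_apply (φ : EvenSchwartz n) : delta n φ = φ.1 0 := rfl

theorem fourierBessel_diamondOp_delta {p q : ℕ} {v : Fin (p + q) → ℝ} (hv : ∀ i, 0 < v i) (k : ℕ)
    (φ : EvenSchwartz (p + q)) :
    fourierBessel v ((diamondOp v ^ k) (delta (p + q))) φ =
      (fbTest hv ((diamondPolyTest p q ^ k) φ)).1 0 := by
  rw [fourierBessel, isTranspose_onDist (realizes_fbTest hv), (isTranspose_diamondOp v).pow k,
    delta_apply, ← mul_apply_eq_comp, ← mul_apply_eq_comp]
  rw [← (semiconjBy_fbTest_diamondTest hv k).eq]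

theorem isFunction_const_mul {v : Fin n → ℝ} (hv : ∀ i, 0 < v i) {T : EvenTempered n}
    {M : EvenSchwartz n →L[ℂ] EvenSchwartz n} {g : EuclideanSpace ℝ (Fin n) → ℝ}
    (hM : IsMultiplication M g) (c : ℝ)
    (hT : ∀ φ, T φ = c * ∫ x, (M φ).1 x ∂besselMeasure v) :
    IsFunction v T fun x => c * g x := by
  intro φ
  have h : ∀ x, ((c * g x * weight v x : ℝ) : ℂ) * φ.1 x =
      (weight v x : ℂ) * (c * (M φ).1 x) := by
    intro x
    rw [hM]
    push_cast
    ring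
  simp only [h]
  exact ⟨(integrableOn_orthant_weight hv).mpr ((integrable_schwartz hv (M φ).1).const_mul _),
    by rw [hT, setIntegral_orthant_weight hv, integral_const_mul]⟩

/-- For `a, b ≥ 0` one has `|a² - b²| ≤ (a + b)²`, and here `a + b = ‖x‖²`. -/
theorem abs_diamondPoly_le {p q : ℕ} (x : EuclideanSpace ℝ (Fin (p + q))) :
    |diamondPoly x| ≤ ‖x‖ ^ 4 := by
  have h : ‖x‖ ^ 2 =
      (∑ i : Fin p, x (Fin.castAdd q i) ^ 2) + ∑ j : Fin q, x (Fin.natAdd p j) ^ 2 := by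
    rw [EuclideanSpace.real_norm_sq_eq, Fin.sum_univ_add]
  have ha : 0 ≤ ∑ i : Fin p, x (Fin.castAdd q i) ^ 2 := Finset.sum_nonneg fun _ _ => sq_nonneg _
  have hb : 0 ≤ ∑ j : Fin q, x (Fin.natAdd p j) ^ 2 := Finset.sum_nonneg fun _ _ => sq_nonneg _
  rw [show ‖x‖ ^ 4 = (‖x‖ ^ 2) ^ 2 by ring, h, diamondPoly, abs_le]
  constructor <;> nlinarith [mul_nonneg ha hb]

end BesselDiamond

end

theorem lemma9 (p q k : ℕ) (v : Fin (p + q) → ℝ) (hv : ∀ i, 0 < v i) :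
    (∀ i, BesselDiamond.Realizes (BesselDiamond.besselDeriv v i)
      (BesselDiamond.onTest (BesselDiamond.besselDeriv v i))) ∧
    BesselDiamond.Realizes (BesselDiamond.fbIntegral v)
      (BesselDiamond.onTest (BesselDiamond.fbIntegral v)) ∧
    BesselDiamond.Realizes (BesselDiamond.fbInvIntegral v)
      (BesselDiamond.onTest (BesselDiamond.fbInvIntegral v)) ∧
    -- the transform of `◇_B^k δ` is the function `C_v P^k`
    BesselDiamond.IsFunction v
      (BesselDiamond.fourierBessel v
        ((BesselDiamond.diamondOp v ^ k) (BesselDiamond.delta (p + q))))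
      (fun x => BesselDiamond.fbConst v * BesselDiamond.diamondPoly x ^ k) ∧
    -- which is bounded by `C_v ‖x‖^(4k)`
    (∀ x ∈ BesselDiamond.orthant (p + q),
      |BesselDiamond.fbConst v * BesselDiamond.diamondPoly x ^ k|
        ≤ BesselDiamond.fbConst v * ‖x‖ ^ (4 * k)) ∧
    -- `F_B ◇_B^k` is continuous and bounded on the tempered distributions
    Continuous (fun T : BesselDiamond.EvenTempered (p + q) =>
      BesselDiamond.fourierBessel v ((BesselDiamond.diamondOp v ^ k) T)) ∧
    (∀ s : Set (BesselDiamond.EvenTempered (p + q)), Bornology.IsVonNBounded ℂ s →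
      Bornology.IsVonNBounded ℂ
        ((fun T => BesselDiamond.fourierBessel v ((BesselDiamond.diamondOp v ^ k) T)) '' s)) ∧
    -- `P^k` is a tempered distribution and `◇_B^k δ = C_v F_B⁻¹ [P^k]`
    ∃ R : BesselDiamond.EvenTempered (p + q),
      BesselDiamond.IsFunction v R (fun x => BesselDiamond.diamondPoly x ^ k) ∧
      (BesselDiamond.diamondOp v ^ k) (BesselDiamond.delta (p + q)) =
        (BesselDiamond.fbConst v : ℂ) • BesselDiamond.fourierBesselInv v R := by
  open BesselDiamond in
  have hF := realizes_fbTest hv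
  have hC := fbConst_pos hv
  have hC' : (fbConst v : ℂ) ≠ 0 := by exact_mod_cast hC.ne'
  have hM := (isMultiplication_diamondPolyTest p q).pow k
  -- Evaluating a transform at the origin is `C_v` times integration, as the kernel is one there.
  have hval : ∀ φ, fourierBessel v ((diamondOp v ^ k) (delta (p + q))) φ =
      fbConst v * ∫ x, ((diamondPolyTest p q ^ k) φ).1 x ∂besselMeasure v := fun φ => by
    rw [fourierBessel_diamondOp_delta hv, fbTest_apply, fbIntegral_zero hv]
  refine ⟨fun i => ?_, ?_, ?_, isFunction_const_mul hv hM _ hval, fun x _ => ?_,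
    ((fourierBessel v).comp (diamondOp v ^ k)).continuous,
    fun s hs => hs.image ((fourierBessel v).comp (diamondOp v ^ k)),
    -- The distribution `P^k` is taken to be the transform already computed, divided by `C_v`; its
    -- continuity then comes for free.
    (fbConst v : ℂ)⁻¹ • fourierBessel v ((diamondOp v ^ k) (delta (p + q))), ?_, ?_⟩
  · rw [(realizes_besselTest v i).onTest_eq]
    exact realizes_besselTest v i
  · rw [hF.onTest_eq]
    exact hF
  · rw [fbInvIntegral_eq hv, hF.onTest_eq]
    exact hF
  · rw [abs_mul, abs_of_pos hC, abs_pow, pow_mul]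
    gcongr
    exact abs_diamondPoly_le x
  · have h := isFunction_const_mul hv (T := (fbConst v : ℂ)⁻¹ •
      fourierBessel v ((diamondOp v ^ k) (delta (p + q)))) hM 1 fun φ => by
        rw [_root_.smul_apply, hval, smul_eq_mul, inv_mul_cancel_left₀ hC', Complex.ofReal_one,
          one_mul]
    simpa only [one_mul] using h
  · rw [map_smul, smul_smul, mul_inv_cancel₀ hC', one_smul]
    ext φ
    -- The pairing with `φ` is `(F (P^k F φ))(0) = (F F ◇^k φ)(0)`, and inversion at the origin
    -- reduces it to `(◇^k φ)(0)`.
    rw [fourierBesselInv, fbInvIntegral_eq hv, isTranspose_onDist hF,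
      fourierBessel_diamondOp_delta hv, ← mul_apply_eq_comp (diamondPolyTest p q ^ k),
      ← (semiconjBy_fbTest_diamondPolyTest hv k).eq, mul_apply_eq_comp, fbTest_fbTest_zero,
      (isTranspose_diamondOp v).pow k, delta_apply]
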